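/- Let $M$ be a smooth manifold (finite-dimensional, Hausdorff, second countable, without boundary) with a smooth action of the torus $\mathbb{T}^2=S^1\times S^1$. For $\xi\in\mathbb{R}^2=\mathrm{Lie}(\mathbb{T}^2)$ let $\xi_M$ be the infinitesimal generator, $\xi_M(x)=\frac{d}{dt}\big|_{t=0}\exp(t\xi)\cdot x$, and let $X_1,X_2$ be the generators for the standard basis of $\mathbb{R}^2$, so that $\xi_M=\xi_1X_1+\xi_2X_2$. Let $h_1,h_2\in C^\infty(M)$ be $\mathbb{T}^2$-invariant functions, and let $V\subseteq M$ be a $\mathbb{T}^2$-saturated open set with $\operatorname{supp}(X_1)\cup\operatorname{supp}(X_2)\subseteq V$ such that $dh_1\wedge dh_2\neq 0$ at every point of $V$. Denote by $\mathcal{O}$ the foliation by the orbits of the action, $T_x\mathcal{O}=\{\xi_M(x):\xi\in\mathbb{R}^2\}$, and by $\mathcal{L}$ the foliation of $V$ by the common level sets of $h_1$ and $h_2$, $T_x\mathcal{L}=\ker (dh_1)_x\cap\ker (dh_2)_x$. Suppose that there is a regular foliation $\mathcal{S}$ of $V$ which is compatible with $\mathcal{L}$ and $\mathcal{O}$, that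 is: 1. $T\mathcal{S}+T\mathcal{L}=TM$ on $V$; 2. $T\mathcal{O}\subseteq T\mathcal{S}$ on $V$; 3. $T\mathcal{O}=T\mathcal{S}\cap T\mathcal{L}$ at every point of $V$ at which $X_1\wedge X_2\neq 0$. Then there exists a Poisson structure $\pi$ on $M$, that is, a smooth bivector field with $[\pi,\pi]=0$ for the Schouten–Nijenhuis bracket, such that the $\mathbb{T}^2$-action is Hamiltonian on $(M,\pi)$ with momentum map $\mathbb{J}:M\to(\mathbb{R}^2)^*$ given by $\mathbb{J}(x)(\xi)=\xi_1h_1(x)+\xi_2h_2(x)$. Explicitly: $\mathbb{T}^2$ acts by Poisson diffeomorphisms, $\mathbb{J}$ is smooth and $\mathbb{T}^2$-invariant (equivalently, equivariant for the coadjoint action, which is trivial), and $\pi(d\mathbb{J}_\xi,\cdot)=\xi_M$ for every $\xi\in\mathbb{R}^2$, where $\mathbb{J}_\xi(x)=\mathbb{J}(x)(\xi)$. -/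

import Mathlib

open scoped Manifold ContDiff Topology

set_option maxSynthPendingDepth 3

noncomputable section

namespace TorusHam

/-! Throughout, `M` is a smooth manifold without boundary, modelled on `ℝᵐ`. The differential of a
real function `f` is Mathlib's `mvfderiv (𝓡 m) f x : TangentSpace (𝓡 m) x →L[ℝ] ℝ`. -/

/-! ### Poisson structures -/

/-- The cotangent space `T*ₓM`. -/
abbrev Cotangent (m : ℕ) {M : Type*} [TopologicalSpace M]
    [ChartedSpace (EuclideanSpace ℝ (Fin m)) M] (x : M) : Type :=
  TangentSpace (𝓡 m) x →L[ℝ] ℝ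

/-- A smooth bivector field `π ∈ Γ(⋀²TM)`, viewed as a smooth family of alternating bilinear forms
on the cotangent spaces. Smoothness is that of a section of the vector bundle
`Hom(T*M, Hom(T*M, ℝ))`. -/
structure BivectorField (m : ℕ) (M : Type*) [TopologicalSpace M]
    [ChartedSpace (EuclideanSpace ℝ (Fin m)) M] [IsManifold (𝓡 m) ∞ M] where
  /-- the value `πₓ(α, β)` -/
  toFun (x : M) : Cotangent m x →L[ℝ] Cotangent m x →L[ℝ] ℝ
  alternating (x : M) (α : Cotangent m x) : toFun x α α = 0
  smooth : ContMDiff (𝓡 m) ((𝓡 m).prod 𝓘(ℝ, (EuclideanSpace ℝ (Fin m) →L[ℝ] ℝ) →L[ℝ]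
      (EuclideanSpace ℝ (Fin m) →L[ℝ] ℝ) →L[ℝ] ℝ)) ∞
    (fun x : M => Bundle.TotalSpace.mk' ((EuclideanSpace ℝ (Fin m) →L[ℝ] ℝ) →L[ℝ]
      (EuclideanSpace ℝ (Fin m) →L[ℝ] ℝ) →L[ℝ] ℝ) x (toFun x))

section Bivector

variable {m : ℕ} {M : Type*} [TopologicalSpace M] [ChartedSpace (EuclideanSpace ℝ (Fin m)) M]
  [IsManifold (𝓡 m) ∞ M]

/-- The function `{f, g} = π(df, dg)`. -/
def BivectorField.bracket (π : BivectorField m M) (f g : M → ℝ) (x : M) : ℝ :=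
  π.toFun x (mvfderiv (𝓡 m) f x) (mvfderiv (𝓡 m) g x)

/-- The Schouten–Nijenhuis bracket `[P, Q]` of two bivector fields, as a trilinear operation on
smooth functions (the evaluation of the trivector field `[P, Q]` on `df, dg, dh`, up to the overall
sign, which varies in the literature):
`[P, Q](f, g, h) = ∑_cyclic (P(Q(f, g), h) + Q(P(f, g), h))`. -/
def schouten (P Q : BivectorField m M) (f g h : M → ℝ) (x : M) : ℝ :=
  (P.bracket (Q.bracket f g) h x + P.bracket (Q.bracket g h) f x
      + P.bracket (Q.bracket h f) g x)
    + (Q.bracket (P.bracket f g) h x + Q.bracket (P.bracket g h) f x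
      + Q.bracket (P.bracket h f) g x)

/-- A bivector field `π` is a Poisson structure if `[π, π] = 0`. A trivector field on a manifold is
zero if and only if it vanishes on all triples of differentials of smooth functions. -/
def BivectorField.IsPoisson (π : BivectorField m M) : Prop :=
  ∀ f g h : M → ℝ, ContMDiff (𝓡 m) 𝓘(ℝ, ℝ) ∞ f → ContMDiff (𝓡 m) 𝓘(ℝ, ℝ) ∞ g →
    ContMDiff (𝓡 m) 𝓘(ℝ, ℝ) ∞ h → ∀ x, schouten π π f g h x = 0

/-- `X = π♯ dh`, that is, `X` is the Hamiltonian vector field of `h`, where `π♯ α = π(α, ·)`. -/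
def BivectorField.IsHamiltonianField (π : BivectorField m M) (h : M → ℝ)
    (X : (x : M) → TangentSpace (𝓡 m) x) : Prop :=
  ∀ (x : M) (β : Cotangent m x), π.toFun x (mvfderiv (𝓡 m) h x) β = β (X x)

end Bivector

/-! ### Actions of the torus -/

/-- The torus `𝕋² = S¹ × S¹`, with its Lie group structure from Mathlib. -/
abbrev Torus : Type := Circle × Circle

/-- The exponential map `ℝ² = Lie(𝕋²) → 𝕋²`, `ξ ↦ (exp(i ξ₁), exp(i ξ₂))`. -/
def torusExp (ξ : Fin 2 → ℝ) : Torus := (Circle.exp (ξ 0), Circle.exp (ξ 1))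

section Action

variable (m : ℕ) {M : Type*} [TopologicalSpace M] [ChartedSpace (EuclideanSpace ℝ (Fin m)) M]
  [MulAction Torus M]

/-- The infinitesimal generator `ξ_M(x) = d/dt|₀ exp(tξ) • x`. -/
def generator (ξ : Fin 2 → ℝ) (x : M) : TangentSpace (𝓡 m) x :=
  mfderiv 𝓘(ℝ, ℝ) (𝓡 m) (fun t : ℝ => torusExp (t • ξ) • x) 0 (1 : ℝ)

/-- The tangent space `T_x𝒪` at `x` to the orbit of `x`. -/
def orbitTangent (x : M) : Submodule ℝ (TangentSpace (𝓡 m) x) :=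
  Submodule.span ℝ (Set.range fun ξ : Fin 2 → ℝ => generator m ξ x)

variable {m}

/-- The `𝕋²`-action is Hamiltonian with respect to `π`, with momentum map `J : M → (ℝ²)*`. -/
structure IsHamiltonianAction [IsManifold (𝓡 m) ∞ M] (π : BivectorField m M)
    (J : M → ((Fin 2 → ℝ) →L[ℝ] ℝ)) : Prop where
  smooth : ContMDiff (𝓡 m) 𝓘(ℝ, (Fin 2 → ℝ) →L[ℝ] ℝ) ∞ J
  /-- the group acts by Poisson diffeomorphisms -/
  canonical (a : Torus) (f g : M → ℝ) : ContMDiff (𝓡 m) 𝓘(ℝ, ℝ) ∞ f →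
    ContMDiff (𝓡 m) 𝓘(ℝ, ℝ) ∞ g → ∀ x : M,
      π.bracket (fun y => f (a • y)) (fun y => g (a • y)) x = π.bracket f g (a • x)
  /-- each infinitesimal generator `ξ_M` has Hamiltonian function `J(·)(ξ)` -/
  generator_eq (ξ : Fin 2 → ℝ) : π.IsHamiltonianField (fun x => J x ξ) (generator m ξ)
  /-- `J` is equivariant; the coadjoint action of the abelian group `𝕋²` is trivial -/
  equivariant (a : Torus) (x : M) : J (a • x) = J x

end Action

/-! ### Foliations -/

/-- A regular foliation of the open set `V ⊆ M`, given by a foliated atlas: charts of `M` that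
cover `V` and whose transition maps have, locally, the form `(x, y) ↦ (g(x, y), h(y))`, where `x`
denotes the first `dim` coordinates (along the leaves) and `y` the remaining (transverse) ones. -/
structure RegularFoliation (m : ℕ) {M : Type*} [TopologicalSpace M]
    [ChartedSpace (EuclideanSpace ℝ (Fin m)) M] (V : Set M) where
  /-- the dimension of the leaves -/
  dim : ℕ
  dim_le : dim ≤ m
  /-- the foliated charts -/
  charts : Set (OpenPartialHomeomorph M (EuclideanSpace ℝ (Fin m)))
  charts_subset : charts ⊆ IsManifold.maximalAtlas (𝓡 m) ∞ M
  source_subset : ∀ φ ∈ charts, φ.source ⊆ V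
  cover : ∀ x ∈ V, ∃ φ ∈ charts, x ∈ φ.source
  compatible : ∀ φ ∈ charts, ∀ ψ ∈ charts, ∀ x ∈ φ.source ∩ ψ.source, ∃ W ∈ 𝓝 x,
    ∀ y ∈ W, ∀ z ∈ W, (∀ i : Fin m, dim ≤ i → φ y i = φ z i) →
      ∀ i : Fin m, dim ≤ i → ψ y i = ψ z i

section Foliation

variable {m : ℕ} {M : Type*} [TopologicalSpace M] [ChartedSpace (EuclideanSpace ℝ (Fin m)) M]
  {V : Set M}

/-- The tangent space at `x` to the plaque through `x` of the chart `φ`: the vectors annihilated by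
the differentials of the coordinates `φᵢ` with `r ≤ i`. -/
def plaqueTangent (r : ℕ) (φ : OpenPartialHomeomorph M (EuclideanSpace ℝ (Fin m))) (x : M) :
    Submodule ℝ (TangentSpace (𝓡 m) x) :=
  ⨅ (i : Fin m) (_ : r ≤ i), (mvfderiv (𝓡 m) (fun y => φ y i) x).ker

/-- The tangent space `T_x𝒮` to the leaf of `𝒮` through `x ∈ V`. All foliated charts around `x`
give the same subspace, see `RegularFoliation.tangent_eq`. -/
def RegularFoliation.tangent (S : RegularFoliation m V) (x : M) :
    Submodule ℝ (TangentSpace (𝓡 m) x) :=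
  ⨅ (φ ∈ S.charts) (_ : x ∈ φ.source), plaqueTangent S.dim φ x

/-- Two foliated charts around `x` have the same plaque tangent space. -/
theorem RegularFoliation.plaqueTangent_le [IsManifold (𝓡 m) ∞ M] (S : RegularFoliation m V)
    {φ ψ : OpenPartialHomeomorph M (EuclideanSpace ℝ (Fin m))} (hφ : φ ∈ S.charts)
    (hψ : ψ ∈ S.charts) {x : M} (hx : x ∈ φ.source) (hx' : x ∈ ψ.source) :
    plaqueTangent S.dim φ x ≤ plaqueTangent S.dim ψ x := by
  obtain ⟨W, hW, hWc⟩ := S.compatible φ hφ ψ hψ x ⟨hx, hx'⟩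
  intro v hv
  simp only [plaqueTangent, Submodule.mem_iInf, LinearMap.mem_ker, ContinuousLinearMap.coe_coe] at hv ⊢
  intro i hi
  have dφ : MDifferentiableAt (𝓡 m) (𝓡 m) φ x :=
    (contMDiffAt_of_mem_maximalAtlas (S.charts_subset hφ) hx).mdifferentiableAt (by simp)
  have dψ : MDifferentiableAt (𝓡 m) (𝓡 m) ψ x :=
    (contMDiffAt_of_mem_maximalAtlas (S.charts_subset hψ) hx').mdifferentiableAt (by simp)
  have hsx : φ.symm (φ x) = x := φ.left_inv hx
  have dsym : MDifferentiableAt (𝓡 m) (𝓡 m) φ.symm (φ x) :=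
    (contMDiffAt_symm_of_mem_maximalAtlas (S.charts_subset hφ) (φ.map_source hx)).mdifferentiableAt
      (by simp)
  have coord : ∀ (j : Fin m) (χ : OpenPartialHomeomorph M (EuclideanSpace ℝ (Fin m))),
      MDifferentiableAt (𝓡 m) (𝓡 m) χ x → ∀ u, mvfderiv (𝓡 m) (fun y => χ y j) x u
        = (show EuclideanSpace ℝ (Fin m) from mfderiv (𝓡 m) (𝓡 m) χ x u) j := by
    intro j χ hχ u
    have h1 : HasMFDerivAt 𝓘(ℝ, EuclideanSpace ℝ (Fin m)) 𝓘(ℝ, ℝ)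
        (fun z : EuclideanSpace ℝ (Fin m) => z j) (χ x)
        (EuclideanSpace.proj j : EuclideanSpace ℝ (Fin m) →L[ℝ] ℝ) :=
      (EuclideanSpace.proj j : EuclideanSpace ℝ (Fin m) →L[ℝ] ℝ).hasMFDerivAt
    have h2 := (h1.comp x hχ.hasMFDerivAt).mfderiv
    have h3 : mfderiv (𝓡 m) 𝓘(ℝ, ℝ) (fun y => χ y j) x u
        = (show EuclideanSpace ℝ (Fin m) from mfderiv (𝓡 m) (𝓡 m) χ x u) j := by
      exact congrArg (fun L => L u) h2
    exact h3
  set w : EuclideanSpace ℝ (Fin m) := mfderiv (𝓡 m) (𝓡 m) φ x v with hw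
  have hwz : ∀ j : Fin m, S.dim ≤ j → w j = 0 := fun j hj => by
    rw [hw]; exact (coord j φ dφ v).symm.trans (hv j hj)
  have hψs : MDifferentiableAt (𝓡 m) (𝓡 m) ψ (φ.symm (φ x)) := by rw [hsx]; exact dψ
  have hF : MDifferentiableAt (𝓡 m) (𝓡 m) (ψ ∘ φ.symm) (φ x) := hψs.comp _ dsym
  have hF' : DifferentiableAt ℝ (ψ ∘ φ.symm) (φ x) := mdifferentiableAt_iff_differentiableAt.1 hF
  have hcomp : mfderiv (𝓡 m) (𝓡 m) ψ x v = fderiv ℝ (ψ ∘ φ.symm) (φ x) w := by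
    have e : ψ =ᶠ[𝓝 x] (ψ ∘ φ.symm) ∘ φ := by
      filter_upwards [φ.open_source.mem_nhds hx] with y hy
      simp [φ.left_inv hy]
    rw [e.mfderiv_eq, mfderiv_comp x hF dφ, mfderiv_eq_fderiv]
    rfl
  have hline : HasDerivAt (fun t : ℝ => (ψ ∘ φ.symm) (φ x + t • w))
      (fderiv ℝ (ψ ∘ φ.symm) (φ x) w) 0 := by
    have h0 : HasDerivAt (fun t : ℝ => φ x + t • w) w 0 := by
      simpa using ((hasDerivAt_id (0 : ℝ)).smul_const w).const_add (φ x)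
    have h1 : HasFDerivAt (ψ ∘ φ.symm) (fderiv ℝ (ψ ∘ φ.symm) (φ x)) (φ x + (0 : ℝ) • w) := by
      simpa using hF'.hasFDerivAt
    exact h1.comp_hasDerivAt (0 : ℝ) h0
  have hlinei : HasDerivAt (fun t : ℝ => ((ψ ∘ φ.symm) (φ x + t • w)) i)
      ((fderiv ℝ (ψ ∘ φ.symm) (φ x) w) i) 0 :=
    (EuclideanSpace.proj i : EuclideanSpace ℝ (Fin m) →L[ℝ] ℝ).hasFDerivAt.comp_hasDerivAt 0 hline
  have hcont : Filter.Tendsto (fun t : ℝ => φ x + t • w) (𝓝 0) (𝓝 (φ x)) := by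
    have : Continuous (fun t : ℝ => φ x + t • w) := by fun_prop
    simpa using this.tendsto 0
  have hconst : (fun t : ℝ => ((ψ ∘ φ.symm) (φ x + t • w)) i) =ᶠ[𝓝 0] fun _ => ψ x i := by
    have hWs : φ.symm ⁻¹' W ∈ 𝓝 (φ x) := by
      apply (φ.symm.continuousAt (φ.map_source hx))
      rw [hsx]; exact hW
    filter_upwards [hcont hWs, hcont (φ.open_target.mem_nhds (φ.map_source hx))] with t h1 h2
    refine hWc _ h1 x (mem_of_mem_nhds hW) (fun j hj => ?_) i hi
    rw [φ.right_inv h2]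
    simp [hwz j hj]
  have : (fderiv ℝ (ψ ∘ φ.symm) (φ x) w) i = 0 :=
    hlinei.unique ((hasDerivAt_const (0 : ℝ) (ψ x i)).congr_of_eventuallyEq hconst)
  rw [coord i ψ dψ v]
  exact (congrArg (fun u : EuclideanSpace ℝ (Fin m) => u i) hcomp).trans this

/-- The tangent space to a foliation can be computed in any foliated chart. -/
theorem RegularFoliation.tangent_eq [IsManifold (𝓡 m) ∞ M] (S : RegularFoliation m V)
    {φ : OpenPartialHomeomorph M (EuclideanSpace ℝ (Fin m))} (hφ : φ ∈ S.charts) {x : M}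
    (hx : x ∈ φ.source) : S.tangent x = plaqueTangent S.dim φ x :=
  le_antisymm (iInf_le_of_le φ (iInf_le_of_le hφ (iInf_le_of_le hx le_rfl)))
    (le_iInf fun _ => le_iInf fun hψ => le_iInf fun hx' => S.plaqueTangent_le hφ hψ hx hx')

/-- The tangent space at `x` to the common level set of `h₁` and `h₂` through `x`, at points where
`dh₁` and `dh₂` are independent. -/
def levelTangent (m : ℕ) {M : Type*} [TopologicalSpace M]
    [ChartedSpace (EuclideanSpace ℝ (Fin m)) M] (h₁ h₂ : M → ℝ) (x : M) :
    Submodule ℝ (TangentSpace (𝓡 m) x) :=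
  (mvfderiv (𝓡 m) h₁ x).ker ⊓ (mvfderiv (𝓡 m) h₂ x).ker

/-- A foliation `𝒮` of `V` is compatible with the foliation `ℒ` by the common level sets of `h₁, h₂`
and the foliation `𝒪` by the orbits of the torus action with generators `X₁, X₂`. -/
structure RegularFoliation.IsCompatible [MulAction Torus M] (S : RegularFoliation m V)
    (X₁ X₂ : (x : M) → TangentSpace (𝓡 m) x) (h₁ h₂ : M → ℝ) : Prop where
  /-- `T𝒮 + Tℒ = TM` -/
  transversal : ∀ x ∈ V, S.tangent x ⊔ levelTangent m h₁ h₂ x = ⊤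
  /-- `T𝒪 ⊆ T𝒮` -/
  invariant : ∀ x ∈ V, orbitTangent m x ≤ S.tangent x
  /-- `T𝒪 = T𝒮 ∩ Tℒ` wherever `X₁ ∧ X₂ ≠ 0` -/
  inter_eq : ∀ x ∈ V, LinearIndependent ℝ ![X₁ x, X₂ x] →
    orbitTangent m x = S.tangent x ⊓ levelTangent m h₁ h₂ x

end Foliation

/-- The support of a vector field. -/
def vectorSupport {m : ℕ} {M : Type*} [TopologicalSpace M]
    [ChartedSpace (EuclideanSpace ℝ (Fin m)) M] (X : (x : M) → TangentSpace (𝓡 m) x) : Set M :=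
  closure {x | X x ≠ 0}

end TorusHam

end

/-! The bivector field is `π = Y₁ ∧ X₁ + Y₂ ∧ X₂`, where `Y₁, Y₂` are smooth torus-invariant vector
fields on `M` which, on the closed saturated set `C = supp X₁ ∪ supp X₂`, are tangent to `𝒮` and
satisfy `dhᵢ(Yⱼ) = δᵢⱼ`. Off `C` nothing is required of them, since `π` vanishes there.

Such fields exist (`RegularFoliation.exists_invariant_section`). Transversality of `𝒮` and `ℒ` and
independence of `dh₁, dh₂` give them locally. The conditions are affine in the vector, so a
partition of unity gives global fields. The conditions are also preserved by the action: the `hᵢ`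
are invariant, and the flows of the generators, being tangent to `𝒮`, preserve `T𝒮`. Averaging over
Haar measure therefore makes the fields invariant without losing the conditions.

Momentum map: `dhᵢ(Xⱼ) = 0` by invariance of `hᵢ`, so on `C` one finds `π(dhᵢ, ·) = Xᵢ`; off `C`
both sides vanish.

Jacobi identity: invariant fields commute with generators (`lieDeriv_generator_comm`), so `[π, π]`
is a multiple of `[Y₁, Y₂] ∧ X₁ ∧ X₂` (`schouten_sumWedge_eq_zero`). This is zero where `X₁ ∧ X₂ =
0`. At any other point a whole neighbourhood lies in `C`, so `[Y₁, Y₂]` annihilates `h₁, h₂` and the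
transverse coordinates of `𝒮`. It thus lies in `T𝒮 ∩ Tℒ = T𝒪`, which `X₁, X₂` span, and the product
vanishes again. -/

noncomputable section

namespace TorusHam

open Bundle MeasureTheory

/-! ### Smooth dependence on parameters of integrals over a compact manifold. -/

section FDeriv

variable {EK HK K : Type*} [NormedAddCommGroup EK] [NormedSpace ℝ EK] [TopologicalSpace HK]
  {IK : ModelWithCorners ℝ EK HK} [TopologicalSpace K] [ChartedSpace HK K] [IsManifold IK ∞ K]
  {E F : Type*} [NormedAddCommGroup E] [NormedSpace ℝ E] [NormedAddCommGroup F] [NormedSpace ℝ F]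

/-- The derivative in the first variable of a smooth family is a smooth family. -/
theorem contMDiffOn_fderiv_left {U : Set E} (hU : IsOpen U) {f : E × K → F}
    (hf : ContMDiffOn (𝓘(ℝ, E).prod IK) 𝓘(ℝ, F) ∞ f (U ×ˢ Set.univ)) :
    ContMDiffOn (𝓘(ℝ, E).prod IK) 𝓘(ℝ, E →L[ℝ] F) ∞
      (fun p => fderiv ℝ (fun y => f (y, p.2)) p.1) (U ×ˢ Set.univ) := by
  intro p hp
  have hnhds : U ×ˢ (Set.univ : Set K) ∈ 𝓝 p := (hU.prod isOpen_univ).mem_nhds hp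
  have hfp : ContMDiffAt (𝓘(ℝ, E).prod IK) 𝓘(ℝ, F) ∞ f p := (hf p hp).contMDiffAt hnhds
  -- The pair `q = (x, k)` serves as the parameter of the family, and its own first component is the
  -- point at which the family is differentiated.
  have h1 : ContMDiffAt ((𝓘(ℝ, E).prod IK).prod 𝓘(ℝ, E)) 𝓘(ℝ, F) ∞
      (Function.uncurry fun (q : E × K) (y : E) => f (y, q.2)) (p, p.1) := by
    have : ContMDiffAt ((𝓘(ℝ, E).prod IK).prod 𝓘(ℝ, E)) (𝓘(ℝ, E).prod IK) ∞
        (fun q : (E × K) × E => (q.2, q.1.2)) (p, p.1) :=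
      contMDiffAt_snd.prodMk (contMDiffAt_snd.comp _ contMDiffAt_fst)
    exact ContMDiffAt.comp (p, p.1) (g := f) hfp this
  have h2 := ContMDiffAt.mfderiv (fun (q : E × K) (y : E) => f (y, q.2)) (fun q => q.1) h1
    contMDiffAt_fst (m := ∞) (by simp)
  have h3 := inTangentCoordinates_model_space (I := 𝓘(ℝ, E)) (I' := 𝓘(ℝ, F))
    (fun q : E × K => q.1) (fun q => f (q.1, q.2))
    (fun q => fderiv ℝ (fun y => f (y, q.2)) q.1) p
  rw [← h3]
  simp only [mfderiv_eq_fderiv] at h2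
  exact h2.contMDiffWithinAt

end FDeriv

theorem exists_bound_of_continuousOn_prod_compact {K E F : Type*} [TopologicalSpace K]
    [CompactSpace K] [TopologicalSpace E] [LocallyCompactSpace E] [SeminormedAddCommGroup F]
    {U : Set E} {f : E × K → F}
    (hf : ContinuousOn f (U ×ˢ Set.univ)) {x : E} (hU : U ∈ 𝓝 x) :
    ∃ C : ℝ, ∃ V ∈ 𝓝 x, V ⊆ U ∧ ∀ y ∈ V, ∀ k, ‖f (y, k)‖ ≤ C := by
  obtain ⟨V, hV, hVU, hVc⟩ := local_compact_nhds hU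
  obtain ⟨C, hC⟩ := (hVc.prod (isCompact_univ (X := K))).exists_bound_of_continuousOn
    (hf.mono (Set.prod_mono hVU le_rfl))
  exact ⟨C, V, hV, hVU, fun y hy k => hC _ ⟨hy, trivial⟩⟩

section ParametricIntegral

universe u
variable {EK HK K : Type*} [NormedAddCommGroup EK] [NormedSpace ℝ EK] [TopologicalSpace HK]
  {IK : ModelWithCorners ℝ EK HK} [TopologicalSpace K] [ChartedSpace HK K] [IsManifold IK ∞ K]
  [CompactSpace K] [MeasurableSpace K] [OpensMeasurableSpace K]
  [SecondCountableTopology K]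
  {E F : Type u} [NormedAddCommGroup E] [NormedSpace ℝ E] [FiniteDimensional ℝ E]
  [NormedAddCommGroup F] [NormedSpace ℝ F] [FiniteDimensional ℝ F]

/-- Differentiation under the integral sign over a compact manifold. -/
theorem hasFDerivAt_integral_compact {μ : Measure K} [IsFiniteMeasure μ] {U : Set E}
    (hU : IsOpen U) {f : E × K → F}
    (hf : ContMDiffOn (𝓘(ℝ, E).prod IK) 𝓘(ℝ, F) ∞ f (U ×ˢ Set.univ)) {x : E} (hx : x ∈ U) :
    HasFDerivAt (fun x => ∫ k, f (x, k) ∂μ)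
      (∫ k, fderiv ℝ (fun y => f (y, k)) x ∂μ) x := by
  have hf' := contMDiffOn_fderiv_left (IK := IK) hU hf
  obtain ⟨C, V, hV, hVU, hC⟩ := exists_bound_of_continuousOn_prod_compact hf'.continuousOn (hU.mem_nhds hx)
  have slice : ∀ {G : Type u} [NormedAddCommGroup G] {g : E × K → G},
      ContinuousOn g (U ×ˢ Set.univ) → ∀ y ∈ U, Continuous fun k => g (y, k) := by
    intro G _ g hg y hy
    rw [← continuousOn_univ]
    exact hg.comp (by fun_prop) (fun k _ => ⟨hy, trivial⟩)
  refine hasFDerivAt_integral_of_dominated_of_fderiv_le (bound := fun _ => C) (s := V)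
    (F' := fun y k => fderiv ℝ (fun y => f (y, k)) y) hV ?_ ?_ ?_ ?_ ?_ ?_
  · filter_upwards [hU.mem_nhds hx] with y hy
    exact (slice hf.continuousOn y hy).aestronglyMeasurable
  · obtain ⟨C', V', hV', -, hC'⟩ := exists_bound_of_continuousOn_prod_compact hf.continuousOn (hU.mem_nhds hx)
    exact Integrable.of_bound (slice hf.continuousOn x hx).aestronglyMeasurable C'
      (Filter.Eventually.of_forall fun k => hC' x (mem_of_mem_nhds hV') k)
  · exact (slice hf'.continuousOn x hx).aestronglyMeasurable
  · exact Filter.Eventually.of_forall fun k y hy => hC y hy k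
  · exact integrable_const _
  · refine Filter.Eventually.of_forall fun k y hy => ?_
    have h1 : ContMDiffAt (𝓘(ℝ, E).prod IK) 𝓘(ℝ, F) ∞ f (y, k) :=
      (hf (y, k) ⟨hVU hy, trivial⟩).contMDiffAt ((hU.prod isOpen_univ).mem_nhds ⟨hVU hy, trivial⟩)
    have h2 : ContMDiffAt 𝓘(ℝ, E) 𝓘(ℝ, F) ∞ (fun z => f (z, k)) y :=
      ContMDiffAt.comp y (g := f) h1 (contMDiffAt_id.prodMk contMDiffAt_const)
    exact (h2.contDiffAt.differentiableAt (by simp)).hasFDerivAt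

/-- The derivative of the integral is the integral of a smooth family again, now with values in `E
→L[ℝ] F`. Hence the induction runs over all targets `F`, and `E` and `F` share a universe so that `E
→L[ℝ] F` stays in it. -/
theorem contDiffOn_integral_compact_nat {μ : Measure K} [IsFiniteMeasure μ] {U : Set E}
    (hU : IsOpen U) (n : ℕ) : ∀ {F : Type u} [NormedAddCommGroup F] [NormedSpace ℝ F]
    [FiniteDimensional ℝ F] {f : E × K → F},
    ContMDiffOn (𝓘(ℝ, E).prod IK) 𝓘(ℝ, F) ∞ f (U ×ˢ Set.univ) →
    ContDiffOn ℝ n (fun x => ∫ k, f (x, k) ∂μ) U := by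
  induction n with
  | zero =>
    intro F _ _ _ f hf
    exact contDiffOn_zero.2 fun x hx =>
      (hasFDerivAt_integral_compact hU hf hx).continuousAt.continuousWithinAt
  | succ n ih =>
    intro F _ _ _ f hf
    rw [Nat.cast_succ, contDiffOn_succ_iff_fderiv_of_isOpen hU]
    refine ⟨fun x hx =>
      (hasFDerivAt_integral_compact hU hf hx).differentiableAt.differentiableWithinAt,
      by simp, ?_⟩
    exact (ih (contMDiffOn_fderiv_left hU hf)).congr fun x hx =>
      (hasFDerivAt_integral_compact hU hf hx).fderiv

theorem contDiffOn_integral_compact {μ : Measure K} [IsFiniteMeasure μ] {U : Set E}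
    (hU : IsOpen U) {f : E × K → F}
    (hf : ContMDiffOn (𝓘(ℝ, E).prod IK) 𝓘(ℝ, F) ∞ f (U ×ˢ Set.univ)) :
    ContDiffOn ℝ ∞ (fun x => ∫ k, f (x, k) ∂μ) U :=
  contDiffOn_infty.2 fun n => contDiffOn_integral_compact_nat hU n hf

end ParametricIntegral

section Manifold

variable {EK HK K : Type*} [NormedAddCommGroup EK] [NormedSpace ℝ EK] [TopologicalSpace HK]
  {IK : ModelWithCorners ℝ EK HK} [TopologicalSpace K] [ChartedSpace HK K] [IsManifold IK ∞ K]
  [CompactSpace K] [MeasurableSpace K] [OpensMeasurableSpace K] [SecondCountableTopology K]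
  {m : ℕ} {M : Type*} [TopologicalSpace M] [ChartedSpace (EuclideanSpace ℝ (Fin m)) M]
  [IsManifold (𝓡 m) ∞ M]
  {F : Type} [NormedAddCommGroup F] [NormedSpace ℝ F] [FiniteDimensional ℝ F]

/-- Integrals over a compact manifold depend smoothly on the parameter. -/
theorem contMDiffAt_integral_compact {μ : Measure K} [IsFiniteMeasure μ] {U : Set M}
    (hU : IsOpen U) {f : M × K → F}
    (hf : ContMDiffOn ((𝓡 m).prod IK) 𝓘(ℝ, F) ∞ f (U ×ˢ Set.univ)) {x : M} (hx : x ∈ U) :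
    ContMDiffAt (𝓡 m) 𝓘(ℝ, F) ∞ (fun x => ∫ k, f (x, k) ∂μ) x := by
  set φ := chartAt (EuclideanSpace ℝ (Fin m)) x with hφ
  have hφm : φ ∈ IsManifold.maximalAtlas (𝓡 m) ∞ M := IsManifold.chart_mem_maximalAtlas x
  set W : Set (EuclideanSpace ℝ (Fin m)) := φ.target ∩ φ.symm ⁻¹' U with hW
  have hWo : IsOpen W := φ.symm.isOpen_inter_preimage hU
  have hxs : x ∈ φ.source := mem_chart_source _ x
  have h1 : ContMDiffOn (𝓘(ℝ, EuclideanSpace ℝ (Fin m)).prod IK) 𝓘(ℝ, F) ∞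
      (fun p : EuclideanSpace ℝ (Fin m) × K => f (φ.symm p.1, p.2)) (W ×ˢ Set.univ) := by
    have h2 : ContMDiffOn (𝓘(ℝ, EuclideanSpace ℝ (Fin m)).prod IK) ((𝓡 m).prod IK) ∞
        (fun p : EuclideanSpace ℝ (Fin m) × K => (φ.symm p.1, p.2)) (W ×ˢ Set.univ) := by
      refine ContMDiffOn.prodMk ?_ contMDiffOn_snd
      exact (contMDiffOn_symm_of_mem_maximalAtlas hφm).comp contMDiffOn_fst
        (fun p hp => hp.1.1)
    exact hf.comp h2 (fun p hp => ⟨hp.1.2, trivial⟩)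
  have h3 := contDiffOn_integral_compact (μ := μ) hWo h1
  have hxW : φ x ∈ W := ⟨φ.map_source hxs, by simpa [φ.left_inv hxs] using hx⟩
  have h4 : ContMDiffAt (𝓡 m) 𝓘(ℝ, F) ∞
      ((fun z => ∫ k, f (φ.symm z, k) ∂μ) ∘ φ) x :=
    ContMDiffAt.comp x (h3.contDiffAt (hWo.mem_nhds hxW)).contMDiffAt
      (contMDiffAt_of_mem_maximalAtlas hφm hxs)
  refine h4.congr_of_eventuallyEq ?_
  filter_upwards [φ.open_source.mem_nhds hxs] with y hy
  simp [φ.left_inv hy]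

end Manifold

/-! ### Derivatives along vector fields, and the commutator of two fields. -/

section

variable {m : ℕ} {M : Type*} [TopologicalSpace M] [ChartedSpace (EuclideanSpace ℝ (Fin m)) M]

/-- The derivative `Y f` of a function along a vector field. -/
def lieDeriv {F : Type*} [NormedAddCommGroup F] [NormedSpace ℝ F]
    (Y : (x : M) → TangentSpace (𝓡 m) x) (f : M → F) (x : M) : F :=
  mvfderiv (𝓡 m) f x (Y x)

theorem lieDeriv_congr {F : Type*} [NormedAddCommGroup F] [NormedSpace ℝ F]
    (Y : (x : M) → TangentSpace (𝓡 m) x) {f g : M → F} {x : M} (h : f =ᶠ[𝓝 x] g) :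
    lieDeriv Y f x = lieDeriv Y g x := by
  have : mfderiv (𝓡 m) 𝓘(ℝ, F) f x = mfderiv (𝓡 m) 𝓘(ℝ, F) g x := h.mfderiv_eq
  exact congrArg (fun L => L (Y x)) this

theorem exists_mvfderiv_chart_eq {φ : OpenPartialHomeomorph M (EuclideanSpace ℝ (Fin m))}
    (hφ : φ ∈ IsManifold.maximalAtlas (𝓡 m) ∞ M) {x : M} (hx : x ∈ φ.source)
    (w : EuclideanSpace ℝ (Fin m)) :
    ∃ v : TangentSpace (𝓡 m) x, mvfderiv (𝓡 m) φ x v = w := by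
  have dφ : MDifferentiableAt (𝓡 m) (𝓡 m) φ x :=
    (contMDiffAt_of_mem_maximalAtlas hφ hx).mdifferentiableAt (by simp)
  have hsx : φ.symm (φ x) = x := φ.left_inv hx
  have dsym : MDifferentiableAt (𝓡 m) (𝓡 m) φ.symm (φ x) :=
    (contMDiffAt_symm_of_mem_maximalAtlas hφ (φ.map_source hx)).mdifferentiableAt (by simp)
  have e : φ ∘ φ.symm =ᶠ[𝓝 (φ x)] id := by
    filter_upwards [φ.open_target.mem_nhds (φ.map_source hx)] with y hy
    simp [φ.right_inv hy]
  have h1 : mfderiv (𝓡 m) (𝓡 m) (φ ∘ φ.symm) (φ x) w = w := by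
    rw [e.mfderiv_eq, mfderiv_id]; rfl
  exact ⟨_, (mfderiv_comp_apply_of_eq (φ x) dφ dsym hsx w).symm.trans h1⟩

/-- Smoothness of a vector field at a point. -/
abbrev SmoothFieldAt (Y : (x : M) → TangentSpace (𝓡 m) x) [IsManifold (𝓡 m) ∞ M] (x : M) : Prop :=
  ContMDiffAt (𝓡 m) ((𝓡 m).prod 𝓘(ℝ, EuclideanSpace ℝ (Fin m))) ∞
    (fun y => (TotalSpace.mk' (EuclideanSpace ℝ (Fin m)) y (Y y) : TangentBundle (𝓡 m) M)) x

theorem mvfderiv_eq_fderiv_comp_chart {f : M → ℝ}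
    {φ : OpenPartialHomeomorph M (EuclideanSpace ℝ (Fin m))}
    (hφ : φ ∈ IsManifold.maximalAtlas (𝓡 m) ∞ M) {x : M} (hx : x ∈ φ.source)
    (hf : MDifferentiableAt (𝓡 m) 𝓘(ℝ, ℝ) f x) (v : TangentSpace (𝓡 m) x) :
    mvfderiv (𝓡 m) f x v = fderiv ℝ (f ∘ φ.symm) (φ x) (mvfderiv (𝓡 m) φ x v) := by
  have dφ : MDifferentiableAt (𝓡 m) (𝓡 m) φ x :=
    (contMDiffAt_of_mem_maximalAtlas hφ hx).mdifferentiableAt (by simp)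
  have hsx : φ.symm (φ x) = x := φ.left_inv hx
  have dsym : MDifferentiableAt (𝓡 m) (𝓡 m) φ.symm (φ x) :=
    (contMDiffAt_symm_of_mem_maximalAtlas hφ (φ.map_source hx)).mdifferentiableAt (by simp)
  have hF : MDifferentiableAt (𝓡 m) 𝓘(ℝ, ℝ) (f ∘ φ.symm) (φ x) :=
    MDifferentiableAt.comp (φ x) (by rw [hsx]; exact hf) dsym
  have e : f =ᶠ[𝓝 x] (f ∘ φ.symm) ∘ φ := by
    filter_upwards [φ.open_source.mem_nhds hx] with y hy
    simp [φ.left_inv hy]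
  have h1 : mfderiv (𝓡 m) 𝓘(ℝ, ℝ) f x = mfderiv (𝓡 m) 𝓘(ℝ, ℝ) ((f ∘ φ.symm) ∘ φ) x :=
    e.mfderiv_eq
  have h2 := mfderiv_comp x hF dφ
  have h3 : mfderiv (𝓡 m) 𝓘(ℝ, ℝ) f x v
      = fderiv ℝ (f ∘ φ.symm) (φ x) (mfderiv (𝓡 m) (𝓡 m) φ x v) := by
    rw [h1, h2, ← mfderiv_eq_fderiv]; rfl
  exact h3

theorem contDiffAt_comp_chart_symm {f : M → ℝ}
    {φ : OpenPartialHomeomorph M (EuclideanSpace ℝ (Fin m))}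
    (hφ : φ ∈ IsManifold.maximalAtlas (𝓡 m) ∞ M) {x : M} (hx : x ∈ φ.source)
    (hf : ContMDiffAt (𝓡 m) 𝓘(ℝ, ℝ) ∞ f x) : ContDiffAt ℝ ∞ (f ∘ φ.symm) (φ x) := by
  have hsx : φ.symm (φ x) = x := φ.left_inv hx
  have dsym := contMDiffAt_symm_of_mem_maximalAtlas hφ (φ.map_source hx)
  exact (ContMDiffAt.comp (φ x) (by rw [hsx]; exact hf) dsym).contDiffAt

variable [IsManifold (𝓡 m) ∞ M]

theorem SmoothFieldAt.lieDeriv {F : Type*} [NormedAddCommGroup F] [NormedSpace ℝ F]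
    {Y : (x : M) → TangentSpace (𝓡 m) x} {f : M → F} {x : M} (hY : SmoothFieldAt Y x)
    (hf : ContMDiffAt (𝓡 m) 𝓘(ℝ, F) ∞ f x) :
    ContMDiffAt (𝓡 m) 𝓘(ℝ, F) ∞ (lieDeriv Y f) x := by
  have h1 := hf.mfderiv_const (m := ∞) (by simp)
  have h2 := ContMDiffAt.clm_apply_of_inCoordinates (b₁ := fun y => y) (b₂ := f) h1 hY hf
  exact (contMDiff_snd_tangentBundle_modelSpace F 𝓘(ℝ, F)).contMDiffAt.comp x h2

/-- The Lie bracket of two vector fields: the commutator of the associated derivations is given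
by a tangent vector. -/
theorem exists_commutator_vector {A B : (x : M) → TangentSpace (𝓡 m) x} {x : M}
    (hA : SmoothFieldAt A x) (hB : SmoothFieldAt B x) :
    ∃ Z : TangentSpace (𝓡 m) x, ∀ f : M → ℝ, (∀ᶠ y in 𝓝 x, ContMDiffAt (𝓡 m) 𝓘(ℝ, ℝ) ∞ f y) →
      lieDeriv A (lieDeriv B f) x - lieDeriv B (lieDeriv A f) x = mvfderiv (𝓡 m) f x Z := by
  set φ := chartAt (EuclideanSpace ℝ (Fin m)) x
  have hφ : φ ∈ IsManifold.maximalAtlas (𝓡 m) ∞ M := IsManifold.chart_mem_maximalAtlas x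
  have hx : x ∈ φ.source := mem_chart_source _ x
  have sφ : ContMDiffAt (𝓡 m) (𝓡 m) ∞ φ x := contMDiffAt_of_mem_maximalAtlas hφ hx
  have sa := hA.lieDeriv sφ
  have sb := hB.lieDeriv sφ
  -- The coordinates of the bracket are found by applying the commutator to the chart itself.
  obtain ⟨Z, hZ⟩ := exists_mvfderiv_chart_eq hφ hx
    (lieDeriv A (lieDeriv B φ) x - lieDeriv B (lieDeriv A φ) x)
  refine ⟨Z, fun f hf => ?_⟩
  -- Chain rule in the chart: `C(Df)` is a Hessian term plus a first-order term. The Hessian is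
  -- symmetric and drops out of the commutator.
  have key : ∀ C D : (x : M) → TangentSpace (𝓡 m) x, SmoothFieldAt D x →
      lieDeriv C (lieDeriv D f) x
        = fderiv ℝ (fderiv ℝ (f ∘ φ.symm)) (φ x) (lieDeriv C φ x) (lieDeriv D φ x)
          + fderiv ℝ (f ∘ φ.symm) (φ x) (lieDeriv C (lieDeriv D φ) x) := by
    intro C D hD
    have e : lieDeriv D f =ᶠ[𝓝 x] fun y => fderiv ℝ (f ∘ φ.symm) (φ y) (lieDeriv D φ y) := by
      filter_upwards [φ.open_source.mem_nhds hx, hf] with y hy hfy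
      exact mvfderiv_eq_fderiv_comp_chart hφ hy (hfy.mdifferentiableAt (by simp)) _
    have sd := hD.lieDeriv sφ
    have c1 := (contDiffAt_comp_chart_symm hφ hx hf.self_of_nhds)
    have c2 : DifferentiableAt ℝ (fderiv ℝ (f ∘ φ.symm)) (φ x) :=
      (c1.fderiv_right (m := ∞) (by simp)).differentiableAt (by simp)
    have g1 := (sφ.mdifferentiableAt (by simp)).hasMFDerivAt
    have g2 := (sd.mdifferentiableAt (by simp)).hasMFDerivAt
    have g3 : HasMFDerivAt (𝓡 m) 𝓘(ℝ, EuclideanSpace ℝ (Fin m) × EuclideanSpace ℝ (Fin m))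
        (fun y => (φ y, lieDeriv D φ y)) x
        ((mvfderiv (𝓡 m) φ x).prod (mvfderiv (𝓡 m) (lieDeriv D φ) x)) :=
      ⟨g1.1.prodMk g2.1, g1.2.prodMk g2.2⟩
    have g4 : HasFDerivAt (fun p : EuclideanSpace ℝ (Fin m) × EuclideanSpace ℝ (Fin m) =>
        fderiv ℝ (f ∘ φ.symm) p.1 p.2) _ (φ x, lieDeriv D φ x) :=
      HasFDerivAt.clm_apply (c2.hasFDerivAt.comp (φ x, lieDeriv D φ x) hasFDerivAt_fst)
        hasFDerivAt_snd
    have g5 := (HasMFDerivAt.comp x g4.hasMFDerivAt g3).mfderiv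
    rw [lieDeriv_congr C e]
    have := congrArg (fun L => L (C x)) g5
    refine Eq.trans this ?_
    rw [add_comm]
    rfl
  rw [key A B hB, key B A hA, mvfderiv_eq_fderiv_comp_chart hφ hx
    (hf.self_of_nhds.mdifferentiableAt (by simp)) Z]
  have sym : IsSymmSndFDerivAt ℝ (f ∘ φ.symm) (φ x) :=
    (contDiffAt_comp_chart_symm hφ hx hf.self_of_nhds).isSymmSndFDerivAt
      (by rw [minSmoothness_of_isRCLikeNormedField]; exact ENat.LEInfty.out)
  rw [sym.eq (lieDeriv A φ x), hZ, map_sub]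
  ring

end

/-! ### Smooth sections of Hom bundles and the bivector of two vector fields. -/

section

section Hom

variable {EB HB B : Type*} [NormedAddCommGroup EB] [NormedSpace ℝ EB] [TopologicalSpace HB]
  {IB : ModelWithCorners ℝ EB HB} [TopologicalSpace B] [ChartedSpace HB B]
  {F₁ F₂ : Type*} [NormedAddCommGroup F₁] [NormedSpace ℝ F₁] [FiniteDimensional ℝ F₁]
  [NormedAddCommGroup F₂] [NormedSpace ℝ F₂]
  {E₁ E₂ : B → Type*} [∀ x, AddCommGroup (E₁ x)] [∀ x, Module ℝ (E₁ x)]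
  [∀ x, TopologicalSpace (E₁ x)] [∀ x, AddCommGroup (E₂ x)] [∀ x, Module ℝ (E₂ x)]
  [∀ x, TopologicalSpace (E₂ x)] [∀ x, IsTopologicalAddGroup (E₂ x)]
  [∀ x, ContinuousSMul ℝ (E₂ x)]
  [TopologicalSpace (TotalSpace F₁ E₁)] [FiberBundle F₁ E₁] [VectorBundle ℝ F₁ E₁]
  [TopologicalSpace (TotalSpace F₂ E₂)] [FiberBundle F₂ E₂] [VectorBundle ℝ F₂ E₂]

/-- In finite dimension `f = ∑ bᵢ* ⊗ f(bᵢ)` for a basis `bᵢ`, so smoothness need only be tested on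
vectors. -/
theorem contMDiffAt_clm_of_apply {f : B → F₁ →L[ℝ] F₂} {x : B}
    (h : ∀ v, ContMDiffAt IB 𝓘(ℝ, F₂) ∞ (fun y => f y v) x) :
    ContMDiffAt IB 𝓘(ℝ, F₁ →L[ℝ] F₂) ∞ f x := by
  let b := Module.finBasis ℝ F₁
  have e : f = fun y => ∑ i, ContinuousLinearMap.smulRightL ℝ F₁ F₂
      (LinearMap.toContinuousLinearMap (b.coord i)) (f y (b i)) := by
    ext y v
    have hv : f y v = f y (∑ i, b.repr v i • b i) := by rw [b.sum_repr]
    rw [hv, map_sum]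
    simp
  rw [e]
  refine contMDiffAt_finsetSum fun i _ => ?_
  exact (ContinuousLinearMap.contMDiff _).contMDiffAt.comp x (h (b i))

/-- A section of a `Hom` bundle is smooth if it maps the constant sections of a trivialization to
smooth sections. -/
theorem contMDiffAt_hom_section {ϕ : (x : B) → E₁ x →L[ℝ] E₂ x} {x : B}
    (h : ∀ v : F₁, ContMDiffAt IB (IB.prod 𝓘(ℝ, F₂)) ∞
      (fun y => TotalSpace.mk' F₂ y (ϕ y ((trivializationAt F₁ E₁ x).symm y v))) x) :
    ContMDiffAt IB (IB.prod 𝓘(ℝ, F₁ →L[ℝ] F₂)) ∞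
      (fun y => TotalSpace.mk' (F₁ →L[ℝ] F₂) (E := fun x => E₁ x →L[ℝ] E₂ x) y (ϕ y)) x := by
  rw [contMDiffAt_hom_bundle]
  refine ⟨contMDiffAt_id, contMDiffAt_clm_of_apply fun v => ?_⟩
  refine ((contMDiffAt_section x).1 (h v)).congr_of_eventuallyEq ?_
  filter_upwards [(trivializationAt F₁ E₁ x).open_baseSet.mem_nhds
      (mem_baseSet_trivializationAt F₁ E₁ x), (trivializationAt F₂ E₂ x).open_baseSet.mem_nhds
      (mem_baseSet_trivializationAt F₂ E₂ x)] with y h1 h2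
  rw [ContinuousLinearMap.inCoordinates_eq h1 h2]
  simp

end Hom

section Trivialization

variable {EB HB B : Type*} [NormedAddCommGroup EB] [NormedSpace ℝ EB] [TopologicalSpace HB]
  {IB : ModelWithCorners ℝ EB HB} [TopologicalSpace B] [ChartedSpace HB B]
  {F₁ : Type*} [NormedAddCommGroup F₁] [NormedSpace ℝ F₁]
  {E₁ : B → Type*} [∀ x, AddCommGroup (E₁ x)] [∀ x, Module ℝ (E₁ x)]
  [∀ x, TopologicalSpace (E₁ x)]
  [TopologicalSpace (TotalSpace F₁ E₁)] [FiberBundle F₁ E₁] [VectorBundle ℝ F₁ E₁]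

theorem contMDiffAt_trivialization_symm [ContMDiffVectorBundle ∞ F₁ E₁ IB] [IsManifold IB ∞ B] (x : B) (v : F₁) :
    ContMDiffAt IB (IB.prod 𝓘(ℝ, F₁)) ∞
      (fun y => TotalSpace.mk' F₁ y ((trivializationAt F₁ E₁ x).symm y v)) x := by
  rw [contMDiffAt_section]
  refine (contMDiffAt_const (c := v)).congr_of_eventuallyEq ?_
  filter_upwards [(trivializationAt F₁ E₁ x).open_baseSet.mem_nhds
      (mem_baseSet_trivializationAt F₁ E₁ x)] with y h1
  rw [Trivialization.apply_mk_symm _ h1]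

end Trivialization

variable {m : ℕ} {M : Type*} [TopologicalSpace M] [ChartedSpace (EuclideanSpace ℝ (Fin m)) M]

/-- The bivector `v ∧ w`, as a bilinear form on covectors. -/
def wedge {x : M} (v w : TangentSpace (𝓡 m) x) :
    Cotangent m x →L[ℝ] Cotangent m x →L[ℝ] ℝ :=
  let ev : EuclideanSpace ℝ (Fin m) → (EuclideanSpace ℝ (Fin m) →L[ℝ] ℝ) →L[ℝ] ℝ :=
    fun u => ContinuousLinearMap.apply ℝ ℝ u
  show (EuclideanSpace ℝ (Fin m) →L[ℝ] ℝ) →L[ℝ] (EuclideanSpace ℝ (Fin m) →L[ℝ] ℝ) →L[ℝ] ℝ from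
  (ev v).smulRight (ev w) - (ev w).smulRight (ev v)

theorem wedge_apply {x : M} (v w : TangentSpace (𝓡 m) x) (α β : Cotangent m x) :
    wedge v w α β = α v * β w - α w * β v := rfl

variable [IsManifold (𝓡 m) ∞ M]

theorem contMDiffAt_wedge {X Y : (x : M) → TangentSpace (𝓡 m) x} {x : M}
    (hX : SmoothFieldAt X x) (hY : SmoothFieldAt Y x) :
    ContMDiffAt (𝓡 m) ((𝓡 m).prod 𝓘(ℝ, (EuclideanSpace ℝ (Fin m) →L[ℝ] ℝ) →L[ℝ]
      (EuclideanSpace ℝ (Fin m) →L[ℝ] ℝ) →L[ℝ] ℝ)) ∞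
    (fun x : M => Bundle.TotalSpace.mk' ((EuclideanSpace ℝ (Fin m) →L[ℝ] ℝ) →L[ℝ]
      (EuclideanSpace ℝ (Fin m) →L[ℝ] ℝ) →L[ℝ] ℝ) x (wedge (X x) (Y x))) x := by
  refine contMDiffAt_hom_section fun α => ?_
  refine contMDiffAt_hom_section fun β => ?_
  have hα := contMDiffAt_trivialization_symm (IB := 𝓡 m) (F₁ := EuclideanSpace ℝ (Fin m) →L[ℝ] ℝ)
    (E₁ := fun x : M => TangentSpace (𝓡 m) x →L[ℝ] ℝ) x α
  have hβ := contMDiffAt_trivialization_symm (IB := 𝓡 m) (F₁ := EuclideanSpace ℝ (Fin m) →L[ℝ] ℝ)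
    (E₁ := fun x : M => TangentSpace (𝓡 m) x →L[ℝ] ℝ) x β
  have key : ∀ {s : (x : M) → TangentSpace (𝓡 m) x →L[ℝ] ℝ} {Z : (x : M) → TangentSpace (𝓡 m) x},
    ContMDiffAt (𝓡 m) ((𝓡 m).prod 𝓘(ℝ, EuclideanSpace ℝ (Fin m) →L[ℝ] ℝ)) ∞
      (fun y => TotalSpace.mk' (EuclideanSpace ℝ (Fin m) →L[ℝ] ℝ) y (s y)) x →
    SmoothFieldAt Z x → ContMDiffAt (𝓡 m) 𝓘(ℝ, ℝ) ∞ (fun y => s y (Z y)) x := by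
    intro s Z hs hZ
    have := ContMDiffAt.clm_bundle_apply (F₂ := ℝ) (E₂ := Trivial M ℝ) hs hZ
    exact (contMDiffAt_section _).1 this
  rw [contMDiffAt_section]
  simp only [wedge_apply]
  exact ((key hα hX).mul (key hβ hY)).sub ((key hα hY).mul (key hβ hX))

end

/-! ### Averaging a vector field over a compact group. -/

section Average

variable {m : ℕ} {M : Type*} [TopologicalSpace M] [ChartedSpace (EuclideanSpace ℝ (Fin m)) M]
  {EK HK K : Type*} [NormedAddCommGroup EK] [NormedSpace ℝ EK] [TopologicalSpace HK]
  {IK : ModelWithCorners ℝ EK HK} [TopologicalSpace K] [ChartedSpace HK K] [Group K]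
  [MulAction K M]

theorem mdifferentiable_smul_const {IK : ModelWithCorners ℝ EK HK}
    [ContMDiffSMul IK (𝓡 m) ∞ K M] (k : K) :
    MDifferentiable (𝓡 m) (𝓡 m) (fun x : M => k • x) :=
  (ContMDiffSMul.contMDiff_const_smul (I := IK) (n := ∞) k).mdifferentiable (by simp)

/-- The vector at `x` obtained by moving `Y (k • x)` back to `x` by means of `k⁻¹`. -/
def translate (Y : (x : M) → TangentSpace (𝓡 m) x) (k : K) (x : M) : EuclideanSpace ℝ (Fin m) :=
  mfderiv (𝓡 m) (𝓡 m) (fun z : M => k⁻¹ • z) (k • x) (Y (k • x))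

/-- This is the chain rule for `k⁻¹ = b (k b)⁻¹`. The substitution `k ↦ k b` on the right is what
the invariance of Haar measure absorbs in `average_smul`. -/
theorem translate_smul {IK : ModelWithCorners ℝ EK HK} [ContMDiffSMul IK (𝓡 m) ∞ K M]
    (Y : (x : M) → TangentSpace (𝓡 m) x)
    (k b : K) (x : M) :
    translate Y k (b • x) = mfderiv (𝓡 m) (𝓡 m) (fun z : M => b • z) x
      (translate Y (k * b) x : TangentSpace (𝓡 m) x) := by
  -- The base point is generalised to `z` because `k • b • x` and `(k * b) • x` index different
  -- tangent spaces.
  have h : ∀ z : M, z = (k * b) • x →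
      mfderiv (𝓡 m) (𝓡 m) (fun z : M => k⁻¹ • z) z (Y z)
      = mfderiv (𝓡 m) (𝓡 m) (fun z : M => b • z) x
          (mfderiv (𝓡 m) (𝓡 m) (fun z : M => (k * b)⁻¹ • z) z (Y z)) := by
    rintro z rfl
    have e : (fun z : M => k⁻¹ • z) = (fun z : M => b • z) ∘ fun z : M => (k * b)⁻¹ • z := by
      ext z
      simp [mul_smul]
    have := mfderiv_comp_apply_of_eq (I := 𝓡 m) (I' := 𝓡 m) (I'' := 𝓡 m) ((k * b) • x)
      (g := fun z : M => b • z) (f := fun z : M => (k * b)⁻¹ • z)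
      (mdifferentiable_smul_const (IK := IK) b x)
      (mdifferentiable_smul_const (IK := IK) (k * b)⁻¹ _) (inv_smul_smul _ _) (Y ((k * b) • x))
    rw [← this, ← e]
  have h1 := h (k • b • x) (mul_smul k b x).symm
  refine h1.trans ?_
  rw [translate, mul_smul]

variable [IsManifold (𝓡 m) ∞ M]

/-- The translate is the tangent map of the action `K × M → M` applied to the zero vector at `k⁻¹`
and to `Y (k • x)`. Smoothness in `(x, k)` jointly follows from that of the tangent map. -/
theorem contMDiff_translate [LieGroup IK ∞ K] [ContMDiffSMul IK (𝓡 m) ∞ K M]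
    {Y : (x : M) → TangentSpace (𝓡 m) x} (hY : ∀ x, SmoothFieldAt Y x) :
    ContMDiff ((𝓡 m).prod IK) ((𝓡 m).prod 𝓘(ℝ, EuclideanSpace ℝ (Fin m))) ∞
      (fun p : M × K => (TotalSpace.mk' (EuclideanSpace ℝ (Fin m)) p.1
        (translate Y p.2 p.1 : TangentSpace (𝓡 m) p.1) : TangentBundle (𝓡 m) M)) := by
  have : IsManifold IK 1 K := IsManifold.of_le (n := ∞) (by simp)
  have hact : ContMDiff (IK.prod (𝓡 m)) (𝓡 m) ∞ (fun p : K × M => p.1 • p.2) :=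
    ContMDiffSMul.contMDiff_smul
  have hact' : ContMDiff ((𝓡 m).prod IK) (𝓡 m) ∞ (fun p : M × K => p.2 • p.1) :=
    hact.comp (contMDiff_snd.prodMk contMDiff_fst)
  have S₀ : ContMDiff ((𝓡 m).prod IK) IK.tangent ∞
      (fun p : M × K => (zeroSection EK (TangentSpace IK) p.2⁻¹ : TangentBundle IK K)) :=
    (contMDiff_zeroSection ℝ _).comp (contMDiff_snd.inv)
  have S₁ : ContMDiff ((𝓡 m).prod IK) (𝓡 m).tangent ∞ (fun p : M × K =>
      (TotalSpace.mk' (EuclideanSpace ℝ (Fin m)) (p.2 • p.1) (Y (p.2 • p.1)) :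
        TangentBundle (𝓡 m) M)) :=
    ContMDiff.comp (g := fun y => (TotalSpace.mk' (EuclideanSpace ℝ (Fin m)) y (Y y) :
        TangentBundle (𝓡 m) M)) (fun x => hY x) hact'
  have S₂ : ContMDiff (IK.tangent.prod (𝓡 m).tangent) (IK.prod (𝓡 m)).tangent ∞
      (equivTangentBundleProd IK K (𝓡 m) M).symm := contMDiff_equivTangentBundleProd_symm
  have S₃ : ContMDiff (IK.prod (𝓡 m)).tangent (𝓡 m).tangent ∞
      (tangentMap (IK.prod (𝓡 m)) (𝓡 m) (fun p : K × M => p.1 • p.2)) :=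
    hact.contMDiff_tangentMap (by simp)
  have S := (S₃.comp S₂).comp (S₀.prodMk S₁)
  refine S.congr fun p => ?_
  have aux : ∀ (y z : M) (h : y = z) (v : EuclideanSpace ℝ (Fin m)),
      (TotalSpace.mk' (EuclideanSpace ℝ (Fin m)) y (v : TangentSpace (𝓡 m) y) :
        TangentBundle (𝓡 m) M)
      = TotalSpace.mk' (EuclideanSpace ℝ (Fin m)) z (v : TangentSpace (𝓡 m) z) := by
    rintro y _ rfl v; rfl
  rw [aux p.1 (p.2⁻¹ • p.2 • p.1) (inv_smul_smul _ _).symm]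
  simp only [Function.comp_apply, tangentMap]
  have h2 := mfderiv_prod_eq_add_apply (I := IK) (I' := 𝓡 m) (I'' := 𝓡 m)
    (f := fun p : K × M => p.1 • p.2) (p := (p.2⁻¹, p.2 • p.1))
    (v := ((0 : EK), (Y (p.2 • p.1) : EuclideanSpace ℝ (Fin m))))
    (hact.mdifferentiable (by simp) (p.2⁻¹, p.2 • p.1))
  have h3 : mfderiv (IK.prod (𝓡 m)) (𝓡 m) (fun p : K × M => p.1 • p.2) (p.2⁻¹, p.2 • p.1)
      ((0 : EK), (Y (p.2 • p.1) : EuclideanSpace ℝ (Fin m))) = translate Y p.2 p.1 :=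
    h2.trans ((congrArg (· + _) (map_zero _)).trans (zero_add _))
  exact congrArg (TotalSpace.mk' (EuclideanSpace ℝ (Fin m)) (p.2⁻¹ • p.2 • p.1)) h3.symm

/-- The average is an integral in the fixed fibre over `x`, while smoothness is known in the total
space. A trivialization near `x`, followed by its inverse on that fibre, passes from one to the
other. -/
theorem continuous_translate [LieGroup IK ∞ K] [ContMDiffSMul IK (𝓡 m) ∞ K M]
    {Y : (x : M) → TangentSpace (𝓡 m) x} (hY : ∀ x, SmoothFieldAt Y x) (x : M) :
    Continuous fun k : K => translate Y k x := by
  have h := (contMDiff_translate (IK := IK) (K := K) hY).continuous.comp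
    (Continuous.prodMk_right x)
  set e := trivializationAt (EuclideanSpace ℝ (Fin m)) (TangentSpace (𝓡 m) : M → Type _) x
  have hx : x ∈ e.baseSet := mem_baseSet_trivializationAt _ _ x
  have h1 : Continuous fun k : K => (e (TotalSpace.mk' (EuclideanSpace ℝ (Fin m)) x
        (translate Y k x : TangentSpace (𝓡 m) x))).2 := by
    have := e.continuousOn.comp_continuous h (fun k => by
      rw [e.mem_source]; exact hx)
    exact continuous_snd.comp this
  have h2 : Continuous fun k : K => e.symmL ℝ x (e (TotalSpace.mk' (EuclideanSpace ℝ (Fin m)) x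
        (translate Y k x : TangentSpace (𝓡 m) x))).2 :=
    (e.symmL ℝ x).continuous.comp h1
  refine h2.congr fun k => ?_
  have h3 : e.continuousLinearMapAt ℝ x (translate Y k x : TangentSpace (𝓡 m) x)
      = (e (TotalSpace.mk' (EuclideanSpace ℝ (Fin m)) x
        (translate Y k x : TangentSpace (𝓡 m) x))).2 :=
    congrArg (fun f => f (translate Y k x : TangentSpace (𝓡 m) x))
      (e.coe_linearMapAt_of_mem (R := ℝ) hx)
  rw [← h3]
  exact e.symmL_continuousLinearMapAt (R := ℝ) hx (translate Y k x : TangentSpace (𝓡 m) x)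

variable [MeasurableSpace K] [BorelSpace K] [CompactSpace K] [SecondCountableTopology K]

/-- The average of a vector field over a compact group acting on the manifold. -/
def average (μ : Measure K) (Y : (x : M) → TangentSpace (𝓡 m) x) (x : M) : TangentSpace (𝓡 m) x :=
  (∫ k, translate Y k x ∂μ : EuclideanSpace ℝ (Fin m))

variable (μ : Measure K) [IsFiniteMeasure μ]

theorem integrable_translate [LieGroup IK ∞ K] [ContMDiffSMul IK (𝓡 m) ∞ K M]
    {Y : (x : M) → TangentSpace (𝓡 m) x} (hY : ∀ x, SmoothFieldAt Y x) (x : M) :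
    Integrable (fun k : K => translate Y k x) μ :=
  (continuous_translate (IK := IK) hY x).integrable_of_hasCompactSupport
    (HasCompactSupport.of_compactSpace _)

/-- A trivialization is linear on fibres, so it commutes with the integral. In it the average
becomes a parametric integral of functions with values in a fixed space. -/
theorem smoothFieldAt_average [LieGroup IK ∞ K] [ContMDiffSMul IK (𝓡 m) ∞ K M]
    {Y : (x : M) → TangentSpace (𝓡 m) x} (hY : ∀ x, SmoothFieldAt Y x) (x : M) :
    SmoothFieldAt (average μ Y) x := by
  set e := trivializationAt (EuclideanSpace ℝ (Fin m)) (TangentSpace (𝓡 m) : M → Type _) x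
  have hx : x ∈ e.baseSet := mem_baseSet_trivializationAt _ _ x
  have h1 : ContMDiffOn ((𝓡 m).prod IK) 𝓘(ℝ, EuclideanSpace ℝ (Fin m)) ∞
      (fun p : M × K => (e (TotalSpace.mk' (EuclideanSpace ℝ (Fin m)) p.1
        (translate Y p.2 p.1 : TangentSpace (𝓡 m) p.1))).2) (e.baseSet ×ˢ Set.univ) := by
    have h2 : ContMDiffOn ((𝓡 m).prod IK) ((𝓡 m).prod 𝓘(ℝ, EuclideanSpace ℝ (Fin m))) ∞ _
      (e.baseSet ×ˢ Set.univ) := e.contMDiffOn.comp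
      (contMDiff_translate (IK := IK) (K := K) hY).contMDiffOn
      (fun p (hp : p ∈ e.baseSet ×ˢ Set.univ) => by
        rw [Set.mem_preimage, e.mem_source]; exact hp.1)
    exact contMDiff_snd.comp_contMDiffOn h2
  have h3 := contMDiffAt_integral_compact (μ := μ) e.open_baseSet h1 hx
  rw [SmoothFieldAt, contMDiffAt_section]
  refine h3.congr_of_eventuallyEq ?_
  filter_upwards [e.open_baseSet.mem_nhds hx] with y hy
  have h4 := (e.continuousLinearMapAt ℝ y : EuclideanSpace ℝ (Fin m) →L[ℝ]
    EuclideanSpace ℝ (Fin m)).integral_comp_comm (integrable_translate (IK := IK) μ hY y)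
  have h5 : ∀ v : TangentSpace (𝓡 m) y, e.continuousLinearMapAt ℝ y v
      = (e (TotalSpace.mk' (EuclideanSpace ℝ (Fin m)) y v)).2 := fun v =>
    congrArg (fun f => f v) (e.coe_linearMapAt_of_mem (R := ℝ) hy)
  refine (h5 _).symm.trans (h4.symm.trans ?_)
  exact integral_congr_ae (Filter.Eventually.of_forall fun k => h5 _)

theorem map_average [LieGroup IK ∞ K] [ContMDiffSMul IK (𝓡 m) ∞ K M]
    {Y : (x : M) → TangentSpace (𝓡 m) x} (hY : ∀ x, SmoothFieldAt Y x) {x : M}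
    {F : Type*} [NormedAddCommGroup F] [NormedSpace ℝ F] [CompleteSpace F]
    (L : EuclideanSpace ℝ (Fin m) →L[ℝ] F) :
    L (average μ Y x) = ∫ k, L (translate Y k x) ∂μ :=
  (L.integral_comp_comm (integrable_translate (IK := IK) μ hY x)).symm

theorem average_smul [LieGroup IK ∞ K] [ContMDiffSMul IK (𝓡 m) ∞ K M] [μ.IsMulRightInvariant]
    {Y : (x : M) → TangentSpace (𝓡 m) x} (hY : ∀ x, SmoothFieldAt Y x) (b : K) (x : M) :
    mfderiv (𝓡 m) (𝓡 m) (fun z : M => b • z) x (average μ Y x) = average μ Y (b • x) := by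
  have : IsTopologicalGroup K := topologicalGroup_of_lieGroup IK ∞
  have h := map_average (IK := IK) μ hY (x := x)
    (show EuclideanSpace ℝ (Fin m) →L[ℝ] EuclideanSpace ℝ (Fin m) from
      mfderiv (𝓡 m) (𝓡 m) (fun z : M => b • z) x)
  refine h.trans ?_
  rw [← integral_mul_right_eq_self _ b]
  exact integral_congr_ae (Filter.Eventually.of_forall fun k => (translate_smul (IK := IK) Y k b x).symm)

end Average

/-! ### Generators and flows of the torus action. -/

section

theorem torusExp_zero : torusExp 0 = 1 := by
  simp [torusExp]

theorem torusExp_add (ξ η : Fin 2 → ℝ) : torusExp (ξ + η) = torusExp ξ * torusExp η := by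
  simp [torusExp, Circle.exp_add]

theorem torusExp_surjective : Function.Surjective torusExp := by
  rintro ⟨a, b⟩
  refine ⟨![Complex.arg a, Complex.arg b], ?_⟩
  simp [torusExp, Circle.exp_arg]

theorem contMDiff_torusExp :
    ContMDiff 𝓘(ℝ, Fin 2 → ℝ) ((𝓡 1).prod (𝓡 1)) ∞ torusExp := by
  have h : ∀ i : Fin 2, ContMDiff 𝓘(ℝ, Fin 2 → ℝ) 𝓘(ℝ, ℝ) ∞ (fun ξ : Fin 2 → ℝ => ξ i) :=
    fun i => (contDiff_apply ℝ ℝ i).contMDiff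
  exact (contMDiff_circleExp.comp (h 0)).prodMk (contMDiff_circleExp.comp (h 1))

theorem flow_zero {M : Type*} [MulAction Torus M] (ξ : Fin 2 → ℝ) (x : M) : torusExp ((0 : ℝ) • ξ) • x = x := by
  rw [zero_smul, torusExp_zero, one_smul]

variable {m : ℕ} {M : Type*} [TopologicalSpace M] [ChartedSpace (EuclideanSpace ℝ (Fin m)) M]
  [MulAction Torus M] [ContMDiffSMul ((𝓡 1).prod (𝓡 1)) (𝓡 m) ∞ Torus M]

theorem contMDiff_torusExp_smul :
    ContMDiff (𝓘(ℝ, Fin 2 → ℝ).prod (𝓡 m)) (𝓡 m) ∞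
      (fun p : (Fin 2 → ℝ) × M => torusExp p.1 • p.2) :=
  (ContMDiffSMul.contMDiff_smul (I := (𝓡 1).prod (𝓡 1)) (I' := 𝓡 m) (n := ∞) (G := Torus)
    (M := M)).comp ((contMDiff_torusExp.comp contMDiff_fst).prodMk contMDiff_snd)

theorem contMDiff_flow (ξ : Fin 2 → ℝ) :
    ContMDiff (𝓘(ℝ, ℝ).prod (𝓡 m)) (𝓡 m) ∞ (fun p : ℝ × M => torusExp (p.1 • ξ) • p.2) := by
  have h : ContMDiff 𝓘(ℝ, ℝ) 𝓘(ℝ, Fin 2 → ℝ) ∞ (fun t : ℝ => t • ξ) := by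
    have : ContDiff ℝ ∞ (fun t : ℝ => t • ξ) := by fun_prop
    exact this.contMDiff
  exact contMDiff_torusExp_smul.comp ((h.comp contMDiff_fst).prodMk contMDiff_snd)

theorem contMDiff_orbit (ξ : Fin 2 → ℝ) (x : M) :
    ContMDiff 𝓘(ℝ, ℝ) (𝓡 m) ∞ (fun t : ℝ => torusExp (t • ξ) • x) :=
  (contMDiff_flow ξ).comp (contMDiff_id.prodMk contMDiff_const)

theorem mdifferentiable_torus_smul (a : Torus) :
    MDifferentiable (𝓡 m) (𝓡 m) (fun x : M => a • x) :=
  mdifferentiable_smul_const (IK := (𝓡 1).prod (𝓡 1)) a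

theorem contMDiff_torus_smul (a : Torus) : ContMDiff (𝓡 m) (𝓡 m) ∞ (fun x : M => a • x) :=
  ContMDiffSMul.contMDiff_const_smul (I := (𝓡 1).prod (𝓡 1)) a

/-- Torus elements preserve the infinitesimal generators. -/
theorem mfderiv_smul_generator (a : Torus) (ξ : Fin 2 → ℝ) (x : M) :
    mfderiv (𝓡 m) (𝓡 m) (fun z : M => a • z) x (generator m ξ x) = generator m ξ (a • x) := by
  have h := mfderiv_comp_apply_of_eq (I := 𝓘(ℝ, ℝ)) (I' := 𝓡 m) (I'' := 𝓡 m) (0 : ℝ)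
    (g := fun z : M => a • z) (f := fun t : ℝ => torusExp (t • ξ) • x)
    (mdifferentiable_torus_smul a x)
    ((contMDiff_orbit ξ x).mdifferentiable (by simp) 0) (flow_zero ξ x) (1 : ℝ)
  have e : (fun z : M => a • z) ∘ (fun t : ℝ => torusExp (t • ξ) • x)
      = fun t : ℝ => torusExp (t • ξ) • a • x := by
    ext t
    simp only [Function.comp_apply, ← mul_smul, mul_comm]
  rw [e] at h
  exact h.symm

/-- Exhibits the generator as the value at `ξ` of a single linear map, so that it is linear in `ξ`.
-/
theorem generator_eq_mfderiv_orbitMap (ξ : Fin 2 → ℝ) (x : M) :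
    generator m ξ x
      = mfderiv 𝓘(ℝ, Fin 2 → ℝ) (𝓡 m) (fun η : Fin 2 → ℝ => torusExp η • x) 0 ξ := by
  have hg : ContMDiff 𝓘(ℝ, Fin 2 → ℝ) (𝓡 m) ∞ (fun η : Fin 2 → ℝ => torusExp η • x) :=
    contMDiff_torusExp_smul.comp (contMDiff_id.prodMk contMDiff_const)
  have hl : HasFDerivAt (fun t : ℝ => t • ξ) (ContinuousLinearMap.toSpanSingleton ℝ ξ) 0 :=
    (ContinuousLinearMap.toSpanSingleton ℝ ξ).hasFDerivAt
  have h := mfderiv_comp_apply_of_eq (I := 𝓘(ℝ, ℝ)) (I' := 𝓘(ℝ, Fin 2 → ℝ)) (I'' := 𝓡 m) (0 : ℝ)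
    (g := fun η : Fin 2 → ℝ => torusExp η • x) (f := fun t : ℝ => t • ξ)
    (hg.mdifferentiable (by simp) 0) hl.differentiableAt.mdifferentiableAt (zero_smul ℝ ξ) (1 : ℝ)
  refine h.trans ?_
  have h2 : mfderiv 𝓘(ℝ, ℝ) 𝓘(ℝ, Fin 2 → ℝ) (fun t : ℝ => t • ξ) 0 (1 : ℝ) = ξ := by
    rw [hl.hasMFDerivAt.mfderiv]
    exact one_smul ℝ ξ
  exact congrArg _ h2

theorem generator_eq_smul_add (ξ : Fin 2 → ℝ) (x : M) :
    generator m ξ x = ξ 0 • generator m ![1, 0] x + ξ 1 • generator m ![0, 1] x := by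
  have hξ : ξ = ξ 0 • ![1, 0] + ξ 1 • ![0, 1] := by
    ext i; fin_cases i <;> simp
  have hz : torusExp (0 : Fin 2 → ℝ) • x = x := by rw [torusExp_zero, one_smul]
  let L : (Fin 2 → ℝ) →L[ℝ] EuclideanSpace ℝ (Fin m) :=
    mfderiv 𝓘(ℝ, Fin 2 → ℝ) (𝓡 m) (fun η : Fin 2 → ℝ => torusExp η • x) 0
  have hL : ∀ η, generator m η x = L η := fun η => generator_eq_mfderiv_orbitMap η x
  rw [hL, hL, hL]
  conv_lhs => rw [hξ]
  exact (map_add L _ _).trans (congrArg₂ _ (map_smul L _ _) (map_smul L _ _))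

theorem mfderiv_flow (ξ : Fin 2 → ℝ) (x : M) (t : ℝ) :
    mfderiv 𝓘(ℝ, ℝ) (𝓡 m) (fun t : ℝ => torusExp (t • ξ) • x) t (1 : ℝ)
      = generator m ξ (torusExp (t • ξ) • x) := by
  have h := mfderiv_comp_apply_of_eq (I := 𝓘(ℝ, ℝ)) (I' := 𝓘(ℝ, ℝ)) (I'' := 𝓡 m) t
    (g := fun s : ℝ => torusExp (s • ξ) • torusExp (t • ξ) • x) (f := fun s : ℝ => s - t)
    ((contMDiff_orbit ξ _).mdifferentiable (by simp) 0)
    (((hasFDerivAt_id t).sub_const t).differentiableAt.mdifferentiableAt) (sub_self t) (1 : ℝ)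
  have e : (fun s : ℝ => torusExp (s • ξ) • torusExp (t • ξ) • x) ∘ (fun s : ℝ => s - t)
      = fun s : ℝ => torusExp (s • ξ) • x := by
    ext s
    simp only [Function.comp_apply, ← mul_smul, ← torusExp_add, ← add_smul, sub_add_cancel]
  rw [e] at h
  refine h.trans ?_
  have h2 : mfderiv 𝓘(ℝ, ℝ) 𝓘(ℝ, ℝ) (fun s : ℝ => s - t) t (1 : ℝ) = (1 : ℝ) := by
    have hs : HasFDerivAt (fun s : ℝ => s - t) (ContinuousLinearMap.id ℝ ℝ) t :=
      (hasFDerivAt_id t).sub_const t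
    exact congrArg (fun L => L (1 : ℝ)) hs.hasMFDerivAt.mfderiv
  exact congrArg _ h2

theorem hasDerivAt_comp_flow (ξ : Fin 2 → ℝ) (x : M) (t : ℝ) {f : M → ℝ}
    (hf : MDifferentiableAt (𝓡 m) 𝓘(ℝ, ℝ) f (torusExp (t • ξ) • x)) :
    HasDerivAt (fun t : ℝ => f (torusExp (t • ξ) • x))
      (lieDeriv (generator m ξ) f (torusExp (t • ξ) • x)) t := by
  have h1 := (contMDiff_orbit (m := m) ξ x).mdifferentiable (by simp) t
  have h2 : DifferentiableAt ℝ (fun t : ℝ => f (torusExp (t • ξ) • x)) t :=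
    (MDifferentiableAt.comp t hf h1).differentiableAt
  have h3 := mvfderiv_comp_apply (I' := 𝓘(ℝ, ℝ)) t hf h1 (1 : ℝ)
  have h4 : deriv (fun t : ℝ => f (torusExp (t • ξ) • x)) t
      = lieDeriv (generator m ξ) f (torusExp (t • ξ) • x) := by
    refine Eq.trans ?_ (h3.trans (congrArg _ (mfderiv_flow ξ x t)))
    rw [← fderiv_apply_one_eq_deriv, ← mfderiv_eq_fderiv]
    rfl
  exact h4 ▸ h2.hasDerivAt

variable [IsManifold (𝓡 m) ∞ M]

theorem smoothFieldAt_generator (ξ : Fin 2 → ℝ) (x : M) : SmoothFieldAt (generator m ξ) x := by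
  have hact := contMDiff_flow (m := m) (M := M) ξ
  have S₀ : ContMDiff (𝓡 m) 𝓘(ℝ, ℝ).tangent ∞
      (fun _ : M => (TotalSpace.mk' ℝ (0 : ℝ) (1 : ℝ) : TangentBundle 𝓘(ℝ, ℝ) ℝ)) :=
    contMDiff_const
  have S₁ : ContMDiff (𝓡 m) (𝓡 m).tangent ∞
      (fun y : M => (zeroSection (EuclideanSpace ℝ (Fin m)) (TangentSpace (𝓡 m)) y :
        TangentBundle (𝓡 m) M)) := contMDiff_zeroSection ℝ _
  have S₂ : ContMDiff (𝓘(ℝ, ℝ).tangent.prod (𝓡 m).tangent) (𝓘(ℝ, ℝ).prod (𝓡 m)).tangent ∞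
      (equivTangentBundleProd 𝓘(ℝ, ℝ) ℝ (𝓡 m) M).symm := contMDiff_equivTangentBundleProd_symm
  have S₃ : ContMDiff (𝓘(ℝ, ℝ).prod (𝓡 m)).tangent (𝓡 m).tangent ∞
      (tangentMap (𝓘(ℝ, ℝ).prod (𝓡 m)) (𝓡 m) (fun p : ℝ × M => torusExp (p.1 • ξ) • p.2)) :=
    hact.contMDiff_tangentMap (by simp)
  have S := (S₃.comp S₂).comp (S₀.prodMk S₁)
  refine (S.congr fun y => ?_) x
  have aux : ∀ (y z : M) (h : y = z) (v : EuclideanSpace ℝ (Fin m)),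
      (TotalSpace.mk' (EuclideanSpace ℝ (Fin m)) y (v : TangentSpace (𝓡 m) y) :
        TangentBundle (𝓡 m) M)
      = TotalSpace.mk' (EuclideanSpace ℝ (Fin m)) z (v : TangentSpace (𝓡 m) z) := by
    rintro y _ rfl v; rfl
  refine (aux y (torusExp ((0 : ℝ) • ξ) • y) (flow_zero ξ y).symm _).trans ?_
  have h2 := mfderiv_prod_eq_add_apply (I := 𝓘(ℝ, ℝ)) (I' := 𝓡 m) (I'' := 𝓡 m)
    (f := fun p : ℝ × M => torusExp (p.1 • ξ) • p.2) (p := ((0 : ℝ), y))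
    (v := ((1 : ℝ), (0 : EuclideanSpace ℝ (Fin m))))
    (hact.mdifferentiable (by simp) ((0 : ℝ), y))
  have h3 : mfderiv (𝓘(ℝ, ℝ).prod (𝓡 m)) (𝓡 m) (fun p : ℝ × M => torusExp (p.1 • ξ) • p.2)
      ((0 : ℝ), y) ((1 : ℝ), (0 : EuclideanSpace ℝ (Fin m))) = generator m ξ y :=
    h2.trans ((congrArg (_ + ·) (map_zero _)).trans (add_zero _))
  exact congrArg (TotalSpace.mk' (EuclideanSpace ℝ (Fin m)) (torusExp ((0 : ℝ) • ξ) • y)) h3.symm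

/-- A vector field is invariant if it is preserved by all elements of the torus. -/
def IsInvariantField (W : (x : M) → TangentSpace (𝓡 m) x) : Prop :=
  ∀ (a : Torus) (x : M), mfderiv (𝓡 m) (𝓡 m) (fun z : M => a • z) x (W x) = W (a • x)

/-- Invariant vector fields commute with the infinitesimal generators. -/
theorem lieDeriv_generator_comm {W : (x : M) → TangentSpace (𝓡 m) x} (hW : IsInvariantField W)
    {x : M} (sW : ∀ x, SmoothFieldAt W x) (ξ : Fin 2 → ℝ) {f : M → ℝ}
    (hf : ContMDiff (𝓡 m) 𝓘(ℝ, ℝ) ∞ f) :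
    lieDeriv (generator m ξ) (lieDeriv W f) x = lieDeriv W (lieDeriv (generator m ξ) f) x := by
  set φ := chartAt (EuclideanSpace ℝ (Fin m)) x
  have hφ : φ ∈ IsManifold.maximalAtlas (𝓡 m) ∞ M := IsManifold.chart_mem_maximalAtlas x
  have hx : x ∈ φ.source := mem_chart_source _ x
  set w : EuclideanSpace ℝ (Fin m) := mvfderiv (𝓡 m) φ x (W x) with hw
  -- Both sides are the mixed second derivative of `H` at `(0, φ x)` in the directions `∂ₜ` and `w`,
  -- taken in the two orders.
  let H : ℝ × EuclideanSpace ℝ (Fin m) → ℝ := fun p => f (torusExp (p.1 • ξ) • φ.symm p.2)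
  have sH : ∀ t, ∀ z ∈ φ.target, ContDiffAt ℝ ∞ H (t, z) := by
    intro t z hz
    have h1 : ContMDiffAt (𝓘(ℝ, ℝ).prod 𝓘(ℝ, EuclideanSpace ℝ (Fin m))) (𝓘(ℝ, ℝ).prod (𝓡 m)) ∞
        (fun p : ℝ × EuclideanSpace ℝ (Fin m) => (p.1, φ.symm p.2)) (t, z) :=
      contMDiffAt_fst.prodMk
        (ContMDiffAt.comp (t, z) (contMDiffAt_symm_of_mem_maximalAtlas hφ hz) contMDiffAt_snd)
    have h2 : ContMDiffAt (𝓘(ℝ, ℝ).prod 𝓘(ℝ, EuclideanSpace ℝ (Fin m))) 𝓘(ℝ, ℝ) ∞ H (t, z) :=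
      ContMDiffAt.comp (t, z) (I' := 𝓘(ℝ, ℝ).prod (𝓡 m))
        (g := fun p : ℝ × M => f (torusExp (p.1 • ξ) • p.2)) ((hf.comp (contMDiff_flow ξ)) (t, φ.symm z)) h1
    rw [← modelWithCornersSelf_prod, chartedSpaceSelf_prod] at h2
    exact h2.contDiffAt
  have hz : φ x ∈ φ.target := φ.map_source hx
  have hH1 : ∀ t, ∀ z ∈ φ.target, HasFDerivAt H (fderiv ℝ H (t, z)) (t, z) := fun t z hz =>
    ((sH t z hz).differentiableAt (by simp)).hasFDerivAt
  have hH2 : HasFDerivAt (fderiv ℝ H) (fderiv ℝ (fderiv ℝ H) (0, φ x)) (0, φ x) :=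
    (((sH 0 (φ x) hz).fderiv_right (m := ∞) (by simp)).differentiableAt (by simp)).hasFDerivAt
  have sym : IsSymmSndFDerivAt ℝ H (0, φ x) := (sH 0 (φ x) hz).isSymmSndFDerivAt
    (by rw [minSmoothness_of_isRCLikeNormedField]; exact ENat.LEInfty.out)
  -- the left-hand side
  have l1 : ∀ t : ℝ, lieDeriv W f (torusExp (t • ξ) • x) = fderiv ℝ H (t, φ x) (0, w) := by
    intro t
    have d1 := mvfderiv_comp_apply (I' := 𝓡 m) (I := 𝓡 m) (g := f)
      (f := fun z : M => torusExp (t • ξ) • z) x (hf.mdifferentiable (by simp) _)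
      (mdifferentiable_torus_smul _ x) (W x)
    have d2 := mvfderiv_eq_fderiv_comp_chart hφ hx
      ((hf.comp (contMDiff_torus_smul (torusExp (t • ξ)))).mdifferentiable (by simp) x) (W x)
    have d3 : HasFDerivAt ((f ∘ fun z : M => torusExp (t • ξ) • z) ∘ φ.symm)
        ((fderiv ℝ H (t, φ x)).comp ((0 : EuclideanSpace ℝ (Fin m) →L[ℝ] ℝ).prod
          (ContinuousLinearMap.id ℝ _))) (φ x) :=
      HasFDerivAt.comp (φ x) (g := H) (f := fun z => (t, z)) (hH1 t (φ x) hz)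
        ((hasFDerivAt_const t (φ x)).prodMk (hasFDerivAt_id (φ x)))
    rw [d3.fderiv] at d2
    have d4 : lieDeriv W f (torusExp (t • ξ) • x)
        = mvfderiv (𝓡 m) f (torusExp (t • ξ) • x)
          (mfderiv (𝓡 m) (𝓡 m) (fun z : M => torusExp (t • ξ) • z) x (W x)) := by
      rw [hW]; rfl
    exact d4.trans (d1.symm.trans d2)
  have l2 : HasDerivAt (fun t : ℝ => fderiv ℝ H (t, φ x) (0, w))
      (fderiv ℝ (fderiv ℝ H) (0, φ x) (1, 0) (0, w)) 0 := by
    have c : HasDerivAt (fun t : ℝ => (t, φ x)) ((1 : ℝ), (0 : EuclideanSpace ℝ (Fin m))) 0 :=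
      (hasDerivAt_id (0 : ℝ)).prodMk (hasDerivAt_const (0 : ℝ) (φ x))
    have := (HasFDerivAt.comp_hasDerivAt (0 : ℝ) (l := fderiv ℝ H) hH2 c).clm_apply
      (hasDerivAt_const (0 : ℝ) ((0 : ℝ), w))
    simpa using this
  have l3 : HasDerivAt (fun t : ℝ => lieDeriv W f (torusExp (t • ξ) • x))
      (lieDeriv (generator m ξ) (lieDeriv W f) x) 0 := by
    have := hasDerivAt_comp_flow (m := m) ξ x 0 (f := lieDeriv W f)
      (((sW _).lieDeriv (hf _)).mdifferentiableAt (by simp))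
    rwa [flow_zero] at this
  have lhs : lieDeriv (generator m ξ) (lieDeriv W f) x
      = fderiv ℝ (fderiv ℝ H) (0, φ x) (1, 0) (0, w) := by
    rw [funext l1] at l3
    exact l3.unique l2
  -- the right-hand side
  have r1 : ∀ z ∈ φ.target, (lieDeriv (generator m ξ) f ∘ φ.symm) z = fderiv ℝ H (0, z) (1, 0) := by
    intro z hz
    have h1 := hasDerivAt_comp_flow (m := m) ξ (φ.symm z) 0 (f := f)
      (hf.mdifferentiable (by simp) _)
    rw [flow_zero] at h1
    have c : HasDerivAt (fun t : ℝ => (t, z)) ((1 : ℝ), (0 : EuclideanSpace ℝ (Fin m))) 0 :=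
      (hasDerivAt_id (0 : ℝ)).prodMk (hasDerivAt_const (0 : ℝ) z)
    exact h1.unique (HasFDerivAt.comp_hasDerivAt (0 : ℝ) (l := H) (hH1 0 z hz) c)
  have r2 : HasFDerivAt (fun z => fderiv ℝ H (0, z) (1, 0))
      ((ContinuousLinearMap.apply ℝ ℝ ((1 : ℝ), (0 : EuclideanSpace ℝ (Fin m)))).comp
        ((fderiv ℝ (fderiv ℝ H) (0, φ x)).comp ((0 : EuclideanSpace ℝ (Fin m) →L[ℝ] ℝ).prod
          (ContinuousLinearMap.id ℝ _)))) (φ x) :=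
    (ContinuousLinearMap.apply ℝ ℝ
      ((1 : ℝ), (0 : EuclideanSpace ℝ (Fin m)))).hasFDerivAt.comp (φ x)
      (HasFDerivAt.comp (φ x) (g := fderiv ℝ H) (f := fun z => ((0 : ℝ), z)) hH2
        ((hasFDerivAt_const (0 : ℝ) (φ x)).prodMk (hasFDerivAt_id (φ x))))
  have r3 : HasFDerivAt (lieDeriv (generator m ξ) f ∘ φ.symm) _ (φ x) :=
    r2.congr_of_eventuallyEq (by
      filter_upwards [φ.open_target.mem_nhds hz] with z hz' using r1 z hz')
  have r4 := mvfderiv_eq_fderiv_comp_chart hφ hx (f := lieDeriv (generator m ξ) f)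
    (((smoothFieldAt_generator ξ x).lieDeriv (hf x)).mdifferentiableAt (by simp)) (W x)
  rw [r3.fderiv] at r4
  rw [lhs, sym.eq]
  exact r4.symm

end

/-! ### Tangent spaces of the foliation and their invariance under the torus. -/

section Tangent

variable {m : ℕ} {M : Type*} [TopologicalSpace M] [ChartedSpace (EuclideanSpace ℝ (Fin m)) M]
  {V : Set M}

theorem RegularFoliation.mem_tangent_iff [IsManifold (𝓡 m) ∞ M] (S : RegularFoliation m V)
    {φ : OpenPartialHomeomorph M (EuclideanSpace ℝ (Fin m))} (hφ : φ ∈ S.charts) {x : M}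
    (hx : x ∈ φ.source) (v : TangentSpace (𝓡 m) x) :
    v ∈ S.tangent x ↔ ∀ i : Fin m, S.dim ≤ i → mvfderiv (𝓡 m) (fun y => φ y i) x v = 0 := by
  rw [S.tangent_eq hφ hx]
  simp only [plaqueTangent, Submodule.mem_iInf]
  rfl

theorem contMDiffAt_chart_coord {φ : OpenPartialHomeomorph M (EuclideanSpace ℝ (Fin m))}
    (hφ : φ ∈ IsManifold.maximalAtlas (𝓡 m) ∞ M) {x : M} (hx : x ∈ φ.source) (i : Fin m) :
    ContMDiffAt (𝓡 m) 𝓘(ℝ, ℝ) ∞ (fun y => φ y i) x :=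
  (EuclideanSpace.proj i : EuclideanSpace ℝ (Fin m) →L[ℝ] ℝ).contMDiff.contMDiffAt.comp x
    (contMDiffAt_of_mem_maximalAtlas hφ hx)

theorem mvfderiv_chart_coord {φ : OpenPartialHomeomorph M (EuclideanSpace ℝ (Fin m))}
    (hφ : φ ∈ IsManifold.maximalAtlas (𝓡 m) ∞ M) {x : M} (hx : x ∈ φ.source) (i : Fin m)
    (v : TangentSpace (𝓡 m) x) :
    mvfderiv (𝓡 m) (fun y => φ y i) x v = mvfderiv (𝓡 m) φ x v i := by
  have h1 : HasMFDerivAt 𝓘(ℝ, EuclideanSpace ℝ (Fin m)) 𝓘(ℝ, ℝ)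
      (fun z : EuclideanSpace ℝ (Fin m) => z i) (φ x)
      (EuclideanSpace.proj i : EuclideanSpace ℝ (Fin m) →L[ℝ] ℝ) :=
    (EuclideanSpace.proj i : EuclideanSpace ℝ (Fin m) →L[ℝ] ℝ).hasMFDerivAt
  have hφx : MDifferentiableAt (𝓡 m) (𝓡 m) φ x :=
    (contMDiffAt_of_mem_maximalAtlas hφ hx).mdifferentiableAt (by simp)
  exact congrArg (fun L => L v) (h1.comp x hφx.hasMFDerivAt).mfderiv

end Tangent

section Invariance

variable {m : ℕ} {M : Type*} [TopologicalSpace M] [ChartedSpace (EuclideanSpace ℝ (Fin m)) M]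
  [IsManifold (𝓡 m) ∞ M] {V : Set M}
  [MulAction Torus M] [ContMDiffSMul ((𝓡 1).prod (𝓡 1)) (𝓡 m) ∞ Torus M]

/-- The flow of a vector field tangent to a foliation locally preserves the transverse coordinates,
hence the tangent spaces of the foliation. -/
theorem RegularFoliation.eventually_mem_tangent_flow_iff (S : RegularFoliation m V)
    (ξ : Fin 2 → ℝ) (hξ : ∀ x ∈ V, generator m ξ x ∈ S.tangent x) {y : M} (hy : y ∈ V) :
    ∀ᶠ s : ℝ in 𝓝 0, ∀ v : TangentSpace (𝓡 m) y,
      mfderiv (𝓡 m) (𝓡 m) (fun z : M => torusExp (s • ξ) • z) y v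
        ∈ S.tangent (torusExp (s • ξ) • y) ↔ v ∈ S.tangent y := by
  obtain ⟨φ, hφ, hyφ⟩ := S.cover y hy
  have hφm := S.charts_subset hφ
  have hc : Continuous (fun p : ℝ × M => torusExp (p.1 • ξ) • p.2) :=
    (contMDiff_flow (m := m) ξ).continuous
  have hA : (fun p : ℝ × M => torusExp (p.1 • ξ) • p.2) ⁻¹' φ.source ∈ 𝓝 ((0 : ℝ), y) :=
    hc.continuousAt.preimage_mem_nhds (by rw [flow_zero]; exact φ.open_source.mem_nhds hyφ)
  rw [nhds_prod_eq, Filter.mem_prod_iff] at hA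
  obtain ⟨T, hT, W, hW, hTW⟩ := hA
  obtain ⟨ε, hε, hεT⟩ := Metric.mem_nhds_iff.1 hT
  have hin : ∀ s ∈ Metric.ball (0 : ℝ) ε, ∀ z ∈ W, torusExp (s • ξ) • z ∈ φ.source :=
    fun s hs z hz => hTW (Set.mk_mem_prod (hεT hs) hz)
  filter_upwards [Metric.ball_mem_nhds (0 : ℝ) hε] with s hs v
  have hsy := hin s hs y (mem_of_mem_nhds hW)
  -- The transverse coordinates have zero derivative along the flow. The equality holds for all `z`
  -- in a neighbourhood of `y`, so it can be differentiated in `z`.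
  have key : ∀ i : Fin m, S.dim ≤ i → ∀ z ∈ W, φ (torusExp (s • ξ) • z) i = φ z i := by
    intro i hi z hz
    have hd : ∀ r ∈ Metric.ball (0 : ℝ) ε,
        HasDerivAt (fun r : ℝ => φ (torusExp (r • ξ) • z) i) 0 r := by
      intro r hr
      have h1 := hasDerivAt_comp_flow (m := m) ξ z r (f := fun y => φ y i)
        ((contMDiffAt_chart_coord hφm (hin r hr z hz) i).mdifferentiableAt (by simp))
      have h2 : lieDeriv (generator m ξ) (fun y => φ y i) (torusExp (r • ξ) • z) = 0 :=
        (S.mem_tangent_iff hφ (hin r hr z hz) _).1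
          (hξ _ (S.source_subset φ hφ (hin r hr z hz))) i hi
      rwa [h2] at h1
    have h3 := Metric.isOpen_ball.is_const_of_deriv_eq_zero
      (convex_ball (0 : ℝ) ε).isPreconnected
      (fun r hr => (hd r hr).differentiableAt.differentiableWithinAt)
      (fun r hr => (hd r hr).deriv) hs (Metric.mem_ball_self hε)
    simpa only [flow_zero] using h3
  rw [S.mem_tangent_iff hφ hsy, S.mem_tangent_iff hφ hyφ]
  refine forall₂_congr fun i hi => ?_
  have h1 := mvfderiv_comp_apply (I := 𝓡 m) (I' := 𝓡 m) (g := fun y => φ y i)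
    (f := fun z : M => torusExp (s • ξ) • z) y
    ((contMDiffAt_chart_coord hφm hsy i).mdifferentiableAt (by simp))
    (mdifferentiable_torus_smul _ y) v
  rw [← h1]
  have h2 : ((fun y => φ y i) ∘ fun z : M => torusExp (s • ξ) • z) =ᶠ[𝓝 y] fun y => φ y i := by
    filter_upwards [hW] with z hz using key i hi z hz
  have h3 : mfderiv (𝓡 m) 𝓘(ℝ, ℝ) ((fun y => φ y i) ∘ fun z : M => torusExp (s • ξ) • z) y
      = mfderiv (𝓡 m) 𝓘(ℝ, ℝ) (fun y => φ y i) y := h2.mfderiv_eq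
  have h4 : mvfderiv (𝓡 m) ((fun y => φ y i) ∘ fun z : M => torusExp (s • ξ) • z) y v
      = mvfderiv (𝓡 m) (fun y => φ y i) y v := congrArg (fun L => L v) h3
  rw [h4]

/-- Write `a = exp ξ`. Along the path `exp(tξ)` tangency of the transported vector is a locally
constant property of `t`, by the local statement at each point of the orbit. As `ℝ` is connected, it
passes from `t = 0` to `t = 1`. -/
theorem RegularFoliation.mem_tangent_smul (S : RegularFoliation m V)
    (hV : ∀ (a : Torus), ∀ x ∈ V, a • x ∈ V)
    (hS : ∀ ξ, ∀ x ∈ V, generator m ξ x ∈ S.tangent x) (a : Torus) {x : M} (hx : x ∈ V)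
    {v : TangentSpace (𝓡 m) x} (hv : v ∈ S.tangent x) :
    mfderiv (𝓡 m) (𝓡 m) (fun z : M => a • z) x v ∈ S.tangent (a • x) := by
  obtain ⟨ξ, rfl⟩ := torusExp_surjective a
  let F : ℝ → TangentBundle (𝓡 m) M → TangentBundle (𝓡 m) M :=
    fun t => tangentMap (𝓡 m) (𝓡 m) (fun z : M => torusExp (t • ξ) • z)
  let P : ℝ → Prop := fun t => (F t ⟨x, v⟩).2 ∈ S.tangent (F t ⟨x, v⟩).1
  have hF : ∀ s t, F (s + t) ⟨x, v⟩ = F s (F t ⟨x, v⟩) := by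
    intro s t
    have e : (fun z : M => torusExp ((s + t) • ξ) • z)
        = (fun z : M => torusExp (s • ξ) • z) ∘ fun z : M => torusExp (t • ξ) • z := by
      ext z
      simp only [Function.comp_apply, ← mul_smul, ← torusExp_add, ← add_smul]
    have := tangentMap_comp_at (I := 𝓡 m) (I' := 𝓡 m) (I'' := 𝓡 m)
      (g := fun z : M => torusExp (s • ξ) • z) (f := fun z : M => torusExp (t • ξ) • z)
      (⟨x, v⟩ : TangentBundle (𝓡 m) M) (mdifferentiable_torus_smul _ _)
      (mdifferentiable_torus_smul _ _)
    rw [← e] at this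
    exact this
  have hP : IsLocallyConstant P := by
    rw [IsLocallyConstant.iff_eventually_eq]
    intro t
    have h1 := S.eventually_mem_tangent_flow_iff ξ (hS ξ) (hV (torusExp (t • ξ)) x hx)
    have h2 : Filter.Tendsto (fun s : ℝ => s - t) (𝓝 t) (𝓝 0) := by
      have : Continuous fun s : ℝ => s - t := by fun_prop
      simpa using this.tendsto t
    filter_upwards [h2.eventually h1] with s hs
    have h3 := hs (F t ⟨x, v⟩).2
    have h4 : P s ↔ (F (s - t) (F t ⟨x, v⟩)).2 ∈ S.tangent (F (s - t) (F t ⟨x, v⟩)).1 := by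
      rw [← hF, sub_add_cancel]
    exact propext (h4.trans h3)
  have h0 : P 0 := by
    have e : (fun z : M => torusExp ((0 : ℝ) • ξ) • z) = id := by
      ext z; exact flow_zero ξ z
    have h : F 0 ⟨x, v⟩ = ⟨x, v⟩ := by
      simp only [F, e]; exact congrFun tangentMap_id _
    change (fun p : TangentBundle (𝓡 m) M => p.2 ∈ S.tangent p.1) (F 0 ⟨x, v⟩)
    rw [h]
    exact hv
  have h1 : P 1 := by rw [hP.apply_eq_of_preconnectedSpace 1 0]; exact h0
  have h2 : ∀ η : Fin 2 → ℝ, (1 : ℝ) • ξ = η →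
      mfderiv (𝓡 m) (𝓡 m) (fun z : M => torusExp η • z) x v ∈ S.tangent (torusExp η • x) := by
    rintro _ rfl; exact h1
  exact h2 ξ (one_smul ℝ ξ)

end Invariance

/-! ### Fields tangent to the foliation with prescribed derivatives of `h₁` and `h₂`. -/

theorem exists_apply_eq_one_zero {E : Type*} [AddCommGroup E] [Module ℝ E]
    {α β : E →ₗ[ℝ] ℝ} (h : LinearIndependent ℝ ![α, β]) : ∃ u, α u = 1 ∧ β u = 0 := by
  by_contra! hne
  have hk : ⨅ _ : Unit, LinearMap.ker β ≤ LinearMap.ker α := by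
    intro u hu
    rw [iInf_const, LinearMap.mem_ker] at hu
    by_contra hα
    rw [LinearMap.mem_ker] at hα
    exact hne ((α u)⁻¹ • u) (by simp [hα]) (by simp [hu])
  have := mem_span_of_iInf_ker_le_ker (L := fun _ : Unit => β) hk
  rw [Set.range_const, Submodule.mem_span_singleton] at this
  obtain ⟨c, hc⟩ := this
  have := LinearIndependent.pair_iff.1 h 1 (-c) (by rw [← hc]; simp)
  exact one_ne_zero this.1

theorem isInvertible_mfderiv_chart {m : ℕ} {M : Type*} [TopologicalSpace M]
    [ChartedSpace (EuclideanSpace ℝ (Fin m)) M] {φ : OpenPartialHomeomorph M (EuclideanSpace ℝ (Fin m))}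
    (hφ : φ ∈ IsManifold.maximalAtlas (𝓡 m) ∞ M) {x : M} (hx : x ∈ φ.source) :
    (mfderiv (𝓡 m) (𝓡 m) φ x).IsInvertible := by
  have h : φ.MDifferentiable (𝓡 m) (𝓡 m) :=
    ⟨(contMDiffOn_of_mem_maximalAtlas hφ).mdifferentiableOn (by simp),
      (contMDiffOn_symm_of_mem_maximalAtlas hφ).mdifferentiableOn (by simp)⟩
  exact ⟨h.mfderiv hx, rfl⟩

section LocalSection

variable {m : ℕ} {M : Type*} [TopologicalSpace M] [ChartedSpace (EuclideanSpace ℝ (Fin m)) M]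
  [IsManifold (𝓡 m) ∞ M] {V : Set M}

/-- Vectors tangent to a foliation extend locally to smooth vector fields tangent to it. -/
theorem RegularFoliation.exists_tangent_field (S : RegularFoliation m V) {x : M}
    {φ : OpenPartialHomeomorph M (EuclideanSpace ℝ (Fin m))} (hφ : φ ∈ S.charts)
    (hx : x ∈ φ.source) {v : TangentSpace (𝓡 m) x} (hv : v ∈ S.tangent x) :
    ∃ W : (x : M) → TangentSpace (𝓡 m) x, W x = v ∧
      ∀ y ∈ φ.source, SmoothFieldAt W y ∧ W y ∈ S.tangent y := by
  have hφm := S.charts_subset hφ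
  -- The extension is the field with constant coordinates `w` in the foliated chart; the transverse
  -- coordinates of `w` are zero.
  let w : EuclideanSpace ℝ (Fin m) := mvfderiv (𝓡 m) φ x v
  let W := VectorField.mpullback (𝓡 m) (𝓡 m) φ
    (fun z : EuclideanSpace ℝ (Fin m) => (w : TangentSpace (𝓡 m) z))
  have hW : ∀ y, W y = (mfderiv (𝓡 m) (𝓡 m) φ y).inverse w := fun y => rfl
  refine ⟨W, ?_, fun y hy => ⟨?_, ?_⟩⟩
  · obtain ⟨e, he⟩ := isInvertible_mfderiv_chart hφm hx
    have hw : w = e v := by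
      change mfderiv (𝓡 m) (𝓡 m) φ x v = e v
      rw [← he]; rfl
    rw [hW, ← he, ContinuousLinearMap.inverse_equiv, hw]
    exact e.symm_apply_apply v
  · exact ContMDiffAt.mpullback_vectorField_preimage (n := ∞)
      (contMDiffAt_vectorSpace_iff_contDiffAt.2 contDiffAt_const)
      (contMDiffAt_of_mem_maximalAtlas hφm hy) (isInvertible_mfderiv_chart hφm hy) (by simp)
  · rw [S.mem_tangent_iff hφ hy]
    intro i hi
    rw [mvfderiv_chart_coord hφm hy]
    obtain ⟨e, he⟩ := isInvertible_mfderiv_chart hφm hy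
    have h1 : mvfderiv (𝓡 m) φ y (W y) = w := by
      change mfderiv (𝓡 m) (𝓡 m) φ y (W y) = w
      rw [hW, ← he, ContinuousLinearMap.inverse_equiv]
      exact e.apply_symm_apply w
    rw [h1]
    exact (mvfderiv_chart_coord hφm hx i v).symm.trans ((S.mem_tangent_iff hφ hx v).1 hv i hi)

/-- Transversality means that every pair of values of `(dh₁, dh₂)` at `x` is attained on `T𝒮`.
Vectors of `T𝒮` dual to `dh₁, dh₂` at `x` are extended along `𝒮`, and near `x` the prescribed values
are reached by a combination of the extensions. -/
theorem RegularFoliation.exists_local_section (S : RegularFoliation m V) {h₁ h₂ : M → ℝ}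
    (s₁ : ContMDiff (𝓡 m) 𝓘(ℝ, ℝ) ∞ h₁) (s₂ : ContMDiff (𝓡 m) 𝓘(ℝ, ℝ) ∞ h₂) {x : M}
    (hx : x ∈ V) (hind : LinearIndependent ℝ ![mvfderiv (𝓡 m) h₁ x, mvfderiv (𝓡 m) h₂ x])
    (htr : S.tangent x ⊔ levelTangent m h₁ h₂ x = ⊤) (a b : ℝ) :
    ∃ U ∈ 𝓝 x, ∃ Y : (x : M) → TangentSpace (𝓡 m) x, ∀ y ∈ U, SmoothFieldAt Y y ∧
      Y y ∈ S.tangent y ∧ mvfderiv (𝓡 m) h₁ y (Y y) = a ∧ mvfderiv (𝓡 m) h₂ y (Y y) = b := by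
  have hlift : ∀ u : TangentSpace (𝓡 m) x, ∃ v ∈ S.tangent x,
      mvfderiv (𝓡 m) h₁ x v = mvfderiv (𝓡 m) h₁ x u ∧
      mvfderiv (𝓡 m) h₂ x v = mvfderiv (𝓡 m) h₂ x u := by
    intro u
    obtain ⟨v, hv, l, hl, rfl⟩ := Submodule.mem_sup.1 (htr ▸ Submodule.mem_top : u ∈ _ ⊔ _)
    have l1 : mvfderiv (𝓡 m) h₁ x l = 0 := hl.1
    have l2 : mvfderiv (𝓡 m) h₂ x l = 0 := hl.2
    exact ⟨v, hv, by rw [map_add, l1, add_zero], by rw [map_add, l2, add_zero]⟩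
  have hind' : LinearIndependent ℝ ![(mvfderiv (𝓡 m) h₁ x : TangentSpace (𝓡 m) x →ₗ[ℝ] ℝ),
      (mvfderiv (𝓡 m) h₂ x : TangentSpace (𝓡 m) x →ₗ[ℝ] ℝ)] := by
    rw [LinearIndependent.pair_iff] at hind ⊢
    intro s t hst
    refine hind s t ?_
    ext u
    exact congrArg (fun L => L u) hst
  have hind'' : LinearIndependent ℝ ![(mvfderiv (𝓡 m) h₂ x : TangentSpace (𝓡 m) x →ₗ[ℝ] ℝ),
      (mvfderiv (𝓡 m) h₁ x : TangentSpace (𝓡 m) x →ₗ[ℝ] ℝ)] :=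
    LinearIndependent.pair_symm_iff.1 hind'
  obtain ⟨u₁, hu₁, hu₁'⟩ := exists_apply_eq_one_zero hind'
  obtain ⟨u₂, hu₂, hu₂'⟩ := exists_apply_eq_one_zero hind''
  obtain ⟨v₁, hv₁, e₁₁, e₁₂⟩ := hlift u₁
  obtain ⟨v₂, hv₂, e₂₁, e₂₂⟩ := hlift u₂
  obtain ⟨φ, hφ, hxφ⟩ := S.cover x hx
  obtain ⟨W₁, hW₁, W₁s⟩ := S.exists_tangent_field hφ hxφ hv₁
  obtain ⟨W₂, hW₂, W₂s⟩ := S.exists_tangent_field hφ hxφ hv₂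
  have sA : ∀ {W : (x : M) → TangentSpace (𝓡 m) x} {h : M → ℝ}, ContMDiff (𝓡 m) 𝓘(ℝ, ℝ) ∞ h →
      (∀ y ∈ φ.source, SmoothFieldAt W y ∧ W y ∈ S.tangent y) →
      ∀ y ∈ φ.source, ContMDiffAt (𝓡 m) 𝓘(ℝ, ℝ) ∞ (lieDeriv W h) y :=
    fun hh hW y hy => (hW y hy).1.lieDeriv (hh y)
  -- The determinant of the matrix of the `Wⱼ hᵢ`, equal to `1` at `x`. The coefficients of `W₁, W₂`
  -- below are Cramer's rule.
  let D : M → ℝ := fun y => lieDeriv W₁ h₁ y * lieDeriv W₂ h₂ y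
    - lieDeriv W₂ h₁ y * lieDeriv W₁ h₂ y
  have sD : ∀ y ∈ φ.source, ContMDiffAt (𝓡 m) 𝓘(ℝ, ℝ) ∞ D y := fun y hy =>
    ((sA s₁ W₁s y hy).mul (sA s₂ W₂s y hy)).sub ((sA s₁ W₂s y hy).mul (sA s₂ W₁s y hy))
  have hDx : D x ≠ 0 := by
    have : D x = 1 := by
      simp only [D, lieDeriv, hW₁, hW₂]
      rw [e₁₁, e₁₂, e₂₁, e₂₂, show mvfderiv (𝓡 m) h₁ x u₁ = 1 from hu₁,
        show mvfderiv (𝓡 m) h₂ x u₁ = 0 from hu₁', show mvfderiv (𝓡 m) h₂ x u₂ = 1 from hu₂,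
        show mvfderiv (𝓡 m) h₁ x u₂ = 0 from hu₂']
      norm_num
    rw [this]; exact one_ne_zero
  refine ⟨φ.source ∩ {y | D y ≠ 0}, Filter.inter_mem (φ.open_source.mem_nhds hxφ)
    ((sD x hxφ).continuousAt.eventually_ne hDx),
    fun y => ((a * lieDeriv W₂ h₂ y - b * lieDeriv W₂ h₁ y) / D y) • W₁ y
      + ((b * lieDeriv W₁ h₁ y - a * lieDeriv W₁ h₂ y) / D y) • W₂ y, ?_⟩
  rintro y ⟨hy, hDy⟩
  have hDy' : D y ≠ 0 := hDy
  refine ⟨?_, ?_, ?_, ?_⟩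
  · have c : ∀ c : ℝ, ContMDiffAt (𝓡 m) 𝓘(ℝ, ℝ) ∞ (fun _ : M => c) y := fun c => contMDiffAt_const
    exact ContMDiffAt.add_section
      (ContMDiffAt.smul_section ((((c a).mul (sA s₂ W₂s y hy)).sub
        ((c b).mul (sA s₁ W₂s y hy))).div₀ (sD y hy) hDy') (W₁s y hy).1)
      (ContMDiffAt.smul_section ((((c b).mul (sA s₁ W₁s y hy)).sub
        ((c a).mul (sA s₂ W₁s y hy))).div₀ (sD y hy) hDy') (W₂s y hy).1)
  · exact Submodule.add_mem _ (Submodule.smul_mem _ _ (W₁s y hy).2)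
      (Submodule.smul_mem _ _ (W₂s y hy).2)
  · rw [map_add, map_smul, map_smul]
    change _ * lieDeriv W₁ h₁ y + _ * lieDeriv W₂ h₁ y = a
    field_simp
    simp only [D]; ring
  · rw [map_add, map_smul, map_smul]
    change _ * lieDeriv W₁ h₂ y + _ * lieDeriv W₂ h₂ y = b
    field_simp
    simp only [D]; ring

theorem RegularFoliation.exists_section [T2Space M] [SecondCountableTopology M]
    (S : RegularFoliation m V) {h₁ h₂ : M → ℝ}
    (s₁ : ContMDiff (𝓡 m) 𝓘(ℝ, ℝ) ∞ h₁) (s₂ : ContMDiff (𝓡 m) 𝓘(ℝ, ℝ) ∞ h₂)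
    (hind : ∀ x ∈ V, LinearIndependent ℝ ![mvfderiv (𝓡 m) h₁ x, mvfderiv (𝓡 m) h₂ x])
    (htr : ∀ x ∈ V, S.tangent x ⊔ levelTangent m h₁ h₂ x = ⊤) {C : Set M} (hC : IsClosed C)
    (hCV : C ⊆ V) (a b : ℝ) :
    ∃ Y : (x : M) → TangentSpace (𝓡 m) x, (∀ x, SmoothFieldAt Y x) ∧ ∀ x ∈ C,
      Y x ∈ S.tangent x ∧ mvfderiv (𝓡 m) h₁ x (Y x) = a ∧ mvfderiv (𝓡 m) h₂ x (Y x) = b := by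
  have : LocallyCompactSpace M := Manifold.locallyCompact_of_finiteDimensional (𝓡 m)
  -- The conditions are imposed only on the closed set `C`. Near a point off `C` the zero field is
  -- admissible, and convexity lets a partition of unity glue the local fields.
  let T : (x : M) → Set (TangentSpace (𝓡 m) x) := fun x =>
    {v | x ∈ C → v ∈ S.tangent x ∧ mvfderiv (𝓡 m) h₁ x v = a ∧ mvfderiv (𝓡 m) h₂ x v = b}
  have hconv : ∀ x, Convex ℝ (T x) := by
    intro x v hv w hw c d hc hd hcd hx
    obtain ⟨v0, v1, v2⟩ := hv hx
    obtain ⟨w0, w1, w2⟩ := hw hx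
    refine ⟨Submodule.add_mem _ (Submodule.smul_mem _ _ v0) (Submodule.smul_mem _ _ w0), ?_, ?_⟩
    · rw [map_add, map_smul, map_smul, v1, w1, ← add_smul, hcd, one_smul]
    · rw [map_add, map_smul, map_smul, v2, w2, ← add_smul, hcd, one_smul]
  have hloc : ∀ x, ∃ U ∈ 𝓝 x, ∃ Y : (x : M) → TangentSpace (𝓡 m) x,
      ContMDiffOn (𝓡 m) ((𝓡 m).prod 𝓘(ℝ, EuclideanSpace ℝ (Fin m))) ∞
        (fun y => (TotalSpace.mk' (EuclideanSpace ℝ (Fin m)) y (Y y) : TangentBundle (𝓡 m) M)) U ∧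
      ∀ y ∈ U, Y y ∈ T y := by
    intro x
    by_cases hx : x ∈ C
    · obtain ⟨U, hU, Y, hY⟩ := S.exists_local_section s₁ s₂ (hCV hx) (hind x (hCV hx))
        (htr x (hCV hx)) a b
      exact ⟨U, hU, Y, fun y hy => (hY y hy).1.contMDiffWithinAt, fun y hy _ => (hY y hy).2⟩
    · refine ⟨Cᶜ, hC.isOpen_compl.mem_nhds hx, fun y => 0, ?_, fun y hy hy' => absurd hy' hy⟩
      exact (contMDiff_zeroSection ℝ _).contMDiffOn
  obtain ⟨s, hs⟩ := exists_contMDiffSection_forall_mem_convex_of_local (n := ⊤) (𝓡 m)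
    (TangentSpace (𝓡 m) : M → Type _) T hconv hloc
  exact ⟨s, fun x => s.contMDiff x, fun x hx => hs x hx⟩

end LocalSection

theorem mvfderiv_smul_of_invariant {m : ℕ} {M : Type*} [TopologicalSpace M]
    [ChartedSpace (EuclideanSpace ℝ (Fin m)) M] [MulAction Torus M]
    [ContMDiffSMul ((𝓡 1).prod (𝓡 1)) (𝓡 m) ∞ Torus M] {h : M → ℝ} (sh : ContMDiff (𝓡 m) 𝓘(ℝ, ℝ) ∞ h)
    (hh : ∀ (a : Torus) x, h (a • x) = h x) (a : Torus) (x : M) (v : TangentSpace (𝓡 m) x) :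
    mvfderiv (𝓡 m) h (a • x) (mfderiv (𝓡 m) (𝓡 m) (fun z : M => a • z) x v)
      = mvfderiv (𝓡 m) h x v := by
  rw [← mvfderiv_comp_apply (I := 𝓡 m) (I' := 𝓡 m) (g := h) (f := fun z : M => a • z) x
    (sh.mdifferentiable (by simp) _) (mdifferentiable_torus_smul a x) v]
  rw [show h ∘ (fun z : M => a • z) = h from funext fun z => hh a z]

section InvariantSection

variable {m : ℕ} {M : Type*} [TopologicalSpace M] [ChartedSpace (EuclideanSpace ℝ (Fin m)) M]
  [IsManifold (𝓡 m) ∞ M] {V : Set M} [T2Space M] [SecondCountableTopology M]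
  [MulAction Torus M] [ContMDiffSMul ((𝓡 1).prod (𝓡 1)) (𝓡 m) ∞ Torus M]

theorem RegularFoliation.exists_invariant_section
    (S : RegularFoliation m V) {h₁ h₂ : M → ℝ}
    (s₁ : ContMDiff (𝓡 m) 𝓘(ℝ, ℝ) ∞ h₁) (s₂ : ContMDiff (𝓡 m) 𝓘(ℝ, ℝ) ∞ h₂)
    (i₁ : ∀ (a : Torus) x, h₁ (a • x) = h₁ x) (i₂ : ∀ (a : Torus) x, h₂ (a • x) = h₂ x)
    (hV : ∀ (a : Torus), ∀ x ∈ V, a • x ∈ V)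
    (hind : ∀ x ∈ V, LinearIndependent ℝ ![mvfderiv (𝓡 m) h₁ x, mvfderiv (𝓡 m) h₂ x])
    (htr : ∀ x ∈ V, S.tangent x ⊔ levelTangent m h₁ h₂ x = ⊤)
    (hS : ∀ ξ, ∀ x ∈ V, generator m ξ x ∈ S.tangent x) {C : Set M} (hC : IsClosed C)
    (hCV : C ⊆ V) (hCs : ∀ (a : Torus), ∀ x ∈ C, a • x ∈ C) (a b : ℝ) :
    ∃ Y : (x : M) → TangentSpace (𝓡 m) x, (∀ x, SmoothFieldAt Y x) ∧ IsInvariantField Y ∧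
      ∀ x ∈ C, Y x ∈ S.tangent x ∧ mvfderiv (𝓡 m) h₁ x (Y x) = a ∧
        mvfderiv (𝓡 m) h₂ x (Y x) = b := by
  obtain ⟨Y, sY, hY⟩ := S.exists_section s₁ s₂ hind htr hC hCV a b
  let _ : MeasurableSpace Torus := borel Torus
  have : BorelSpace Torus := ⟨rfl⟩
  -- Normalised to total mass one, so that averaging keeps the constants `a` and `b`.
  let μ : Measure Torus := Measure.haarMeasure ⊤
  have : IsProbabilityMeasure μ := ⟨by
    have := Measure.haarMeasure_self (K₀ := (⊤ : TopologicalSpace.PositiveCompacts Torus))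
    simpa using this⟩
  -- Each translate satisfies the conditions on `C`, because `C`, `T𝒮` and the `hᵢ` are all
  -- invariant. The conditions are given by linear functionals, so they pass to the integral.
  have htrans : ∀ k : Torus, ∀ x ∈ C,
      (translate Y k x : TangentSpace (𝓡 m) x) ∈ S.tangent x ∧
      mvfderiv (𝓡 m) h₁ x (translate Y k x) = a ∧ mvfderiv (𝓡 m) h₂ x (translate Y k x) = b := by
    intro k x hx
    obtain ⟨y0, y1, y2⟩ := hY (k • x) (hCs k x hx)
    have t0 := S.mem_tangent_smul hV hS k⁻¹ (hV k x (hCV hx)) y0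
    have t1 := mvfderiv_smul_of_invariant s₁ i₁ k⁻¹ (k • x) (Y (k • x))
    have t2 := mvfderiv_smul_of_invariant s₂ i₂ k⁻¹ (k • x) (Y (k • x))
    rw [y1] at t1
    rw [y2] at t2
    have key : ∀ z : M, z = x → ∀ v : EuclideanSpace ℝ (Fin m),
        ((v : TangentSpace (𝓡 m) z) ∈ S.tangent z ∧
          mvfderiv (𝓡 m) h₁ z v = a ∧ mvfderiv (𝓡 m) h₂ z v = b) →
        ((v : TangentSpace (𝓡 m) x) ∈ S.tangent x ∧
          mvfderiv (𝓡 m) h₁ x v = a ∧ mvfderiv (𝓡 m) h₂ x v = b) := by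
      rintro _ rfl v hv; exact hv
    exact key _ (inv_smul_smul k x) _ ⟨t0, t1, t2⟩
  have avg : ∀ x, ∀ L : TangentSpace (𝓡 m) x →L[ℝ] ℝ, ∀ c : ℝ,
      (∀ k : Torus, L (translate Y k x) = c) → L (average μ Y x) = c := by
    intro x L c hL
    have h := map_average (IK := (𝓡 1).prod (𝓡 1)) μ sY (x := x)
      (L : EuclideanSpace ℝ (Fin m) →L[ℝ] ℝ)
    refine h.trans ?_
    refine (integral_congr_ae (Filter.Eventually.of_forall hL)).trans ?_
    simp
  refine ⟨average μ Y, smoothFieldAt_average (IK := (𝓡 1).prod (𝓡 1)) μ sY,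
    fun a x => average_smul (IK := (𝓡 1).prod (𝓡 1)) μ sY a x, fun x hx => ⟨?_, ?_, ?_⟩⟩
  · obtain ⟨φ, hφ, hxφ⟩ := S.cover x (hCV hx)
    rw [S.mem_tangent_iff hφ hxφ]
    intro i hi
    exact avg x _ 0 fun k => (S.mem_tangent_iff hφ hxφ _).1 (htrans k x hx).1 i hi
  · exact avg x _ a fun k => (htrans k x hx).2.1
  · exact avg x _ b fun k => (htrans k x hx).2.2

end InvariantSection

/-! ### The bivector `Y₁ ∧ X₁ + Y₂ ∧ X₂` and its Jacobiator. -/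

section LieDeriv

variable {m : ℕ} {M : Type*} [TopologicalSpace M] [ChartedSpace (EuclideanSpace ℝ (Fin m)) M]

theorem lieDeriv_mul {C : (x : M) → TangentSpace (𝓡 m) x} {f g : M → ℝ} {x : M}
    (hf : MDifferentiableAt (𝓡 m) 𝓘(ℝ, ℝ) f x) (hg : MDifferentiableAt (𝓡 m) 𝓘(ℝ, ℝ) g x) :
    lieDeriv C (f * g) x = f x * lieDeriv C g x + g x * lieDeriv C f x :=
  congrArg (fun L => L (C x)) (mvfderiv_mul hf hg)

theorem lieDeriv_add {C : (x : M) → TangentSpace (𝓡 m) x} {f g : M → ℝ} {x : M}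
    (hf : MDifferentiableAt (𝓡 m) 𝓘(ℝ, ℝ) f x) (hg : MDifferentiableAt (𝓡 m) 𝓘(ℝ, ℝ) g x) :
    lieDeriv C (f + g) x = lieDeriv C f x + lieDeriv C g x :=
  congrArg (fun L => L (C x)) (mvfderiv_add hf hg)

theorem lieDeriv_sub {C : (x : M) → TangentSpace (𝓡 m) x} {f g : M → ℝ} {x : M}
    (hf : MDifferentiableAt (𝓡 m) 𝓘(ℝ, ℝ) f x) (hg : MDifferentiableAt (𝓡 m) 𝓘(ℝ, ℝ) g x) :
    lieDeriv C (f - g) x = lieDeriv C f x - lieDeriv C g x :=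
  congrArg (fun L => L (C x)) (mvfderiv_sub hf hg)

theorem lieDeriv_const {C : (x : M) → TangentSpace (𝓡 m) x} (c : ℝ) (x : M) :
    lieDeriv C (fun _ : M => c) x = 0 :=
  congrArg (fun L => L (C x)) (mvfderiv_const (I := 𝓡 m) c)

end LieDeriv

section Bivector

variable {m : ℕ} {M : Type*} [TopologicalSpace M] [ChartedSpace (EuclideanSpace ℝ (Fin m)) M]
  [IsManifold (𝓡 m) ∞ M]

/-- The bivector field `Y₁ ∧ X₁ + Y₂ ∧ X₂`. -/
def sumWedge (X₁ X₂ Y₁ Y₂ : (x : M) → TangentSpace (𝓡 m) x) (hX₁ : ∀ x, SmoothFieldAt X₁ x)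
    (hX₂ : ∀ x, SmoothFieldAt X₂ x) (hY₁ : ∀ x, SmoothFieldAt Y₁ x)
    (hY₂ : ∀ x, SmoothFieldAt Y₂ x) : BivectorField m M where
  toFun x := wedge (Y₁ x) (X₁ x) + wedge (Y₂ x) (X₂ x)
  alternating x α := by
    have h : ∀ v w : TangentSpace (𝓡 m) x, wedge v w α α = 0 := fun v w => by
      rw [wedge_apply]; ring
    change wedge (Y₁ x) (X₁ x) α α + wedge (Y₂ x) (X₂ x) α α = 0
    rw [h, h, add_zero]
  smooth x := ContMDiffAt.add_section (contMDiffAt_wedge (hY₁ x) (hX₁ x))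
    (contMDiffAt_wedge (hY₂ x) (hX₂ x))

variable {X₁ X₂ Y₁ Y₂ : (x : M) → TangentSpace (𝓡 m) x} (hX₁ : ∀ x, SmoothFieldAt X₁ x)
    (hX₂ : ∀ x, SmoothFieldAt X₂ x) (hY₁ : ∀ x, SmoothFieldAt Y₁ x)
    (hY₂ : ∀ x, SmoothFieldAt Y₂ x)

theorem sumWedge_apply (x : M) (α β : Cotangent m x) :
    (sumWedge X₁ X₂ Y₁ Y₂ hX₁ hX₂ hY₁ hY₂).toFun x α β
      = (α (Y₁ x) * β (X₁ x) - α (X₁ x) * β (Y₁ x))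
        + (α (Y₂ x) * β (X₂ x) - α (X₂ x) * β (Y₂ x)) := rfl

theorem sumWedge_bracket (f g : M → ℝ) (x : M) :
    (sumWedge X₁ X₂ Y₁ Y₂ hX₁ hX₂ hY₁ hY₂).bracket f g x
      = (lieDeriv Y₁ f x * lieDeriv X₁ g x - lieDeriv X₁ f x * lieDeriv Y₁ g x)
        + (lieDeriv Y₂ f x * lieDeriv X₂ g x - lieDeriv X₂ f x * lieDeriv Y₂ g x) := rfl

/-- The Leibniz rule, written out so that the Jacobiator becomes a polynomial in first and second
derivatives at `x`. -/
theorem lieDeriv_sumWedge_bracket (C : (x : M) → TangentSpace (𝓡 m) x) {f g : M → ℝ}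
    (hf : ContMDiff (𝓡 m) 𝓘(ℝ, ℝ) ∞ f) (hg : ContMDiff (𝓡 m) 𝓘(ℝ, ℝ) ∞ g) (x : M) :
    lieDeriv C ((sumWedge X₁ X₂ Y₁ Y₂ hX₁ hX₂ hY₁ hY₂).bracket f g) x
      = ((lieDeriv Y₁ f x * lieDeriv C (lieDeriv X₁ g) x
            + lieDeriv X₁ g x * lieDeriv C (lieDeriv Y₁ f) x)
          - (lieDeriv X₁ f x * lieDeriv C (lieDeriv Y₁ g) x
            + lieDeriv Y₁ g x * lieDeriv C (lieDeriv X₁ f) x))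
        + ((lieDeriv Y₂ f x * lieDeriv C (lieDeriv X₂ g) x
            + lieDeriv X₂ g x * lieDeriv C (lieDeriv Y₂ f) x)
          - (lieDeriv X₂ f x * lieDeriv C (lieDeriv Y₂ g) x
            + lieDeriv Y₂ g x * lieDeriv C (lieDeriv X₂ f) x)) := by
  have d : ∀ {W : (x : M) → TangentSpace (𝓡 m) x} {k : M → ℝ}, (∀ x, SmoothFieldAt W x) →
      ContMDiff (𝓡 m) 𝓘(ℝ, ℝ) ∞ k → ContMDiffAt (𝓡 m) 𝓘(ℝ, ℝ) ∞ (lieDeriv W k) x :=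
    fun hW hk => (hW x).lieDeriv (hk x)
  have d' : ∀ {k : M → ℝ}, ContMDiffAt (𝓡 m) 𝓘(ℝ, ℝ) ∞ k x → MDifferentiableAt (𝓡 m) 𝓘(ℝ, ℝ) k x :=
    fun hk => hk.mdifferentiableAt (by simp)
  have term : ∀ {X Y : (x : M) → TangentSpace (𝓡 m) x}, (∀ x, SmoothFieldAt X x) →
      (∀ x, SmoothFieldAt Y x) →
      MDifferentiableAt (𝓡 m) 𝓘(ℝ, ℝ)
        (lieDeriv Y f * lieDeriv X g - lieDeriv X f * lieDeriv Y g) x ∧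
      lieDeriv C (lieDeriv Y f * lieDeriv X g - lieDeriv X f * lieDeriv Y g) x
        = (lieDeriv Y f x * lieDeriv C (lieDeriv X g) x
            + lieDeriv X g x * lieDeriv C (lieDeriv Y f) x)
          - (lieDeriv X f x * lieDeriv C (lieDeriv Y g) x
            + lieDeriv Y g x * lieDeriv C (lieDeriv X f) x) := by
    intro X Y hX hY
    have m₁ : MDifferentiableAt (𝓡 m) 𝓘(ℝ, ℝ) (lieDeriv Y f * lieDeriv X g) x :=
      d' ((d hY hf).mul (d hX hg))
    have m₂ : MDifferentiableAt (𝓡 m) 𝓘(ℝ, ℝ) (lieDeriv X f * lieDeriv Y g) x :=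
      d' ((d hX hf).mul (d hY hg))
    refine ⟨m₁.sub m₂, ?_⟩
    rw [lieDeriv_sub m₁ m₂, lieDeriv_mul (d' (d hY hf)) (d' (d hX hg)),
      lieDeriv_mul (d' (d hX hf)) (d' (d hY hg))]
  have e : (sumWedge X₁ X₂ Y₁ Y₂ hX₁ hX₂ hY₁ hY₂).bracket f g =
      (lieDeriv Y₁ f * lieDeriv X₁ g - lieDeriv X₁ f * lieDeriv Y₁ g)
        + (lieDeriv Y₂ f * lieDeriv X₂ g - lieDeriv X₂ f * lieDeriv Y₂ g) := rfl
  rw [e, lieDeriv_add (term hX₁ hY₁).1 (term hX₂ hY₂).1, (term hX₁ hY₁).2, (term hX₂ hY₂).2]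

/-- If the `Xᵢ` commute with each other and with the `Yⱼ`, then the Jacobiator of
`Y₁ ∧ X₁ + Y₂ ∧ X₂` is given by `[Y₁, Y₂] ∧ X₁ ∧ X₂`. -/
theorem schouten_sumWedge_eq_zero {x : M}
    (c : ∀ k : M → ℝ, ContMDiff (𝓡 m) 𝓘(ℝ, ℝ) ∞ k →
      lieDeriv X₁ (lieDeriv Y₁ k) x = lieDeriv Y₁ (lieDeriv X₁ k) x ∧
      lieDeriv X₁ (lieDeriv Y₂ k) x = lieDeriv Y₂ (lieDeriv X₁ k) x ∧
      lieDeriv X₂ (lieDeriv Y₁ k) x = lieDeriv Y₁ (lieDeriv X₂ k) x ∧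
      lieDeriv X₂ (lieDeriv Y₂ k) x = lieDeriv Y₂ (lieDeriv X₂ k) x ∧
      lieDeriv X₁ (lieDeriv X₂ k) x = lieDeriv X₂ (lieDeriv X₁ k) x)
    {Z : TangentSpace (𝓡 m) x}
    (hZ : ∀ k : M → ℝ, ContMDiff (𝓡 m) 𝓘(ℝ, ℝ) ∞ k →
      lieDeriv Y₁ (lieDeriv Y₂ k) x - lieDeriv Y₂ (lieDeriv Y₁ k) x = mvfderiv (𝓡 m) k x Z)
    (hdet : ∀ α β γ : Cotangent m x,
      α Z * (β (X₁ x) * γ (X₂ x) - β (X₂ x) * γ (X₁ x))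
        + β Z * (γ (X₁ x) * α (X₂ x) - γ (X₂ x) * α (X₁ x))
        + γ Z * (α (X₁ x) * β (X₂ x) - α (X₂ x) * β (X₁ x)) = 0)
    {f g h : M → ℝ} (hf : ContMDiff (𝓡 m) 𝓘(ℝ, ℝ) ∞ f) (hg : ContMDiff (𝓡 m) 𝓘(ℝ, ℝ) ∞ g)
    (hh : ContMDiff (𝓡 m) 𝓘(ℝ, ℝ) ∞ h) :
    schouten (sumWedge X₁ X₂ Y₁ Y₂ hX₁ hX₂ hY₁ hY₂) (sumWedge X₁ X₂ Y₁ Y₂ hX₁ hX₂ hY₁ hY₂)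
      f g h x = 0 := by
  have key := hdet (mvfderiv (𝓡 m) f x) (mvfderiv (𝓡 m) g x) (mvfderiv (𝓡 m) h x)
  rw [← hZ f hf, ← hZ g hg, ← hZ h hh] at key
  obtain ⟨f1, f2, f3, f4, f5⟩ := c f hf
  obtain ⟨g1, g2, g3, g4, g5⟩ := c g hg
  obtain ⟨h1, h2, h3, h4, h5⟩ := c h hh
  change (lieDeriv Y₁ (lieDeriv Y₂ f) x - lieDeriv Y₂ (lieDeriv Y₁ f) x)
      * (lieDeriv X₁ g x * lieDeriv X₂ h x - lieDeriv X₂ g x * lieDeriv X₁ h x)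
    + (lieDeriv Y₁ (lieDeriv Y₂ g) x - lieDeriv Y₂ (lieDeriv Y₁ g) x)
      * (lieDeriv X₁ h x * lieDeriv X₂ f x - lieDeriv X₂ h x * lieDeriv X₁ f x)
    + (lieDeriv Y₁ (lieDeriv Y₂ h) x - lieDeriv Y₂ (lieDeriv Y₁ h) x)
      * (lieDeriv X₁ f x * lieDeriv X₂ g x - lieDeriv X₂ f x * lieDeriv X₁ g x) = 0 at key
  simp only [schouten]
  simp only [sumWedge_bracket _ _ _ _ (BivectorField.bracket _ _ _)]
  simp only [lieDeriv_sumWedge_bracket hX₁ hX₂ hY₁ hY₂ _ hf hg,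
    lieDeriv_sumWedge_bracket hX₁ hX₂ hY₁ hY₂ _ hg hh,
    lieDeriv_sumWedge_bracket hX₁ hX₂ hY₁ hY₂ _ hh hf,
    f1, f2, f3, f4, f5, g1, g2, g3, g4, g5, h1, h2, h3, h4, h5]
  -- The factor 2 appears because the two halves of `schouten` coincide for equal arguments.
  linear_combination (-2) * key

/-- Continuity is applied to the coordinates of `X` in a chart, whose differential is injective. It
puts a neighbourhood of a point with `X₁ ≠ 0` inside the support. -/
theorem eventually_ne_zero {X : (x : M) → TangentSpace (𝓡 m) x} {x : M}
    (sX : SmoothFieldAt X x) (hx : X x ≠ 0) : ∀ᶠ y in 𝓝 x, X y ≠ 0 := by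
  set φ := chartAt (EuclideanSpace ℝ (Fin m)) x
  have hφ : φ ∈ IsManifold.maximalAtlas (𝓡 m) ∞ M := IsManifold.chart_mem_maximalAtlas x
  have hxφ : x ∈ φ.source := mem_chart_source _ x
  have hne : lieDeriv X φ x ≠ 0 := by
    obtain ⟨e, he⟩ := isInvertible_mfderiv_chart hφ hxφ
    intro h0
    have h1 : mfderiv (𝓡 m) (𝓡 m) φ x (X x) = 0 := h0
    rw [← he] at h1
    exact hx (e.map_eq_zero_iff.1 h1)
  filter_upwards [(sX.lieDeriv (contMDiffAt_of_mem_maximalAtlas hφ hxφ)).continuousAt.eventually_ne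
    hne] with y hy h0
  exact hy (by rw [lieDeriv, h0, map_zero])

end Bivector

/-! ### Invariance of supports and functions, and the assembly of the proof. -/

section Main

variable {m : ℕ} {M : Type*} [TopologicalSpace M] [ChartedSpace (EuclideanSpace ℝ (Fin m)) M]
  [MulAction Torus M] [ContMDiffSMul ((𝓡 1).prod (𝓡 1)) (𝓡 m) ∞ Torus M]

theorem smul_mem_vectorSupport {X : (x : M) → TangentSpace (𝓡 m) x} (hX : IsInvariantField X)
    (a : Torus) {x : M} (hx : x ∈ vectorSupport X) : a • x ∈ vectorSupport X := by
  refine map_mem_closure (contMDiff_torus_smul (m := m) a).continuous hx fun y hy h0 => hy ?_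
  have h := hX a⁻¹ (a • y)
  rw [h0, map_zero] at h
  have key : ∀ z, z = y → 0 = X z → X y = 0 := by rintro _ rfl h; exact h.symm
  exact key _ (inv_smul_smul a y) h

theorem lieDeriv_comp_smul {W : (x : M) → TangentSpace (𝓡 m) x} (hW : IsInvariantField W)
    {f : M → ℝ} (hf : ContMDiff (𝓡 m) 𝓘(ℝ, ℝ) ∞ f) (a : Torus) (x : M) :
    lieDeriv W (fun y => f (a • y)) x = lieDeriv W f (a • x) := by
  have h := mvfderiv_comp_apply (I := 𝓡 m) (I' := 𝓡 m) (g := f) (f := fun z : M => a • z) x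
    (hf.mdifferentiable (by simp) _) (mdifferentiable_torus_smul a x) (W x)
  rw [hW a x] at h
  exact h

theorem lieDeriv_generator_of_invariant {h : M → ℝ} (sh : ContMDiff (𝓡 m) 𝓘(ℝ, ℝ) ∞ h)
    (hh : ∀ (a : Torus) x, h (a • x) = h x) (ξ : Fin 2 → ℝ) (x : M) :
    mvfderiv (𝓡 m) h x (generator m ξ x) = 0 := by
  have h1 := hasDerivAt_comp_flow (m := m) ξ x 0 (sh.mdifferentiable (by simp) _)
  rw [flow_zero] at h1
  exact h1.unique (by simpa only [hh] using hasDerivAt_const (0 : ℝ) (h x))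

end Main

end TorusHam

end

open TorusHam in
theorem theorem6p9 {m : ℕ} {M : Type*} [TopologicalSpace M] [T2Space M]
    [SecondCountableTopology M] [ChartedSpace (EuclideanSpace ℝ (Fin m)) M]
    [IsManifold (𝓡 m) ∞ M]
    [MulAction Torus M] [ContMDiffSMul ((𝓡 1).prod (𝓡 1)) (𝓡 m) ∞ Torus M]
    (X₁ X₂ : (x : M) → TangentSpace (𝓡 m) x)
    (hX₁ : X₁ = generator m ![1, 0]) (hX₂ : X₂ = generator m ![0, 1])
    (h₁ h₂ : M → ℝ)
    (h₁_smooth : ContMDiff (𝓡 m) 𝓘(ℝ, ℝ) ∞ h₁) (h₂_smooth : ContMDiff (𝓡 m) 𝓘(ℝ, ℝ) ∞ h₂)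
    (h₁_invariant : ∀ (a : Torus) (x : M), h₁ (a • x) = h₁ x)
    (h₂_invariant : ∀ (a : Torus) (x : M), h₂ (a • x) = h₂ x)
    (V : Set M) (V_open : IsOpen V)
    (V_saturated : ∀ (a : Torus), ∀ x ∈ V, a • x ∈ V)
    (V_support : vectorSupport X₁ ∪ vectorSupport X₂ ⊆ V)
    (h_independent : ∀ x ∈ V,
      LinearIndependent ℝ ![mvfderiv (𝓡 m) h₁ x, mvfderiv (𝓡 m) h₂ x])
    (S : RegularFoliation m V) (S_compatible : S.IsCompatible X₁ X₂ h₁ h₂) :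
    ∃ (π : BivectorField m M) (J : M → ((Fin 2 → ℝ) →L[ℝ] ℝ)),
      π.IsPoisson ∧ (∀ (x : M) (ξ : Fin 2 → ℝ), J x ξ = ξ 0 * h₁ x + ξ 1 * h₂ x) ∧
        IsHamiltonianAction π J := by
  have iX₁ : IsInvariantField X₁ := by
    rw [hX₁]; exact fun a x => mfderiv_smul_generator a _ x
  have iX₂ : IsInvariantField X₂ := by
    rw [hX₂]; exact fun a x => mfderiv_smul_generator a _ x
  have sX₁ : ∀ x, SmoothFieldAt X₁ x := by
    rw [hX₁]; exact fun x => smoothFieldAt_generator _ x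
  have sX₂ : ∀ x, SmoothFieldAt X₂ x := by
    rw [hX₂]; exact fun x => smoothFieldAt_generator _ x
  have gen : ∀ ξ x, generator m ξ x = ξ 0 • X₁ x + ξ 1 • X₂ x := by
    rw [hX₁, hX₂]; exact generator_eq_smul_add
  set C := vectorSupport X₁ ∪ vectorSupport X₂ with hC
  have C_closed : IsClosed C := isClosed_closure.union isClosed_closure
  have C_saturated : ∀ (a : Torus), ∀ x ∈ C, a • x ∈ C := fun a x hx =>
    hx.imp (smul_mem_vectorSupport iX₁ a) (smul_mem_vectorSupport iX₂ a)
  have mem_C : ∀ x, x ∉ C → X₁ x = 0 ∧ X₂ x = 0 := fun x hx =>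
    ⟨by_contra fun h => hx (Or.inl (subset_closure h)),
      by_contra fun h => hx (Or.inr (subset_closure h))⟩
  have tangent_S : ∀ ξ, ∀ x ∈ V, generator m ξ x ∈ S.tangent x := fun ξ x hx =>
    S_compatible.invariant x hx (Submodule.subset_span ⟨ξ, rfl⟩)
  have exists_Y := S.exists_invariant_section h₁_smooth h₂_smooth h₁_invariant h₂_invariant
    V_saturated h_independent S_compatible.transversal tangent_S C_closed V_support C_saturated
  obtain ⟨Y₁, sY₁, iY₁, hY₁⟩ := exists_Y 1 0
  obtain ⟨Y₂, sY₂, iY₂, hY₂⟩ := exists_Y 0 1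
  have dJ : ∀ (x : M) (ξ : Fin 2 → ℝ) (v : TangentSpace (𝓡 m) x),
      mvfderiv (𝓡 m) (fun y => ξ 0 * h₁ y + ξ 1 * h₂ y) x v
        = ξ 0 * mvfderiv (𝓡 m) h₁ x v + ξ 1 * mvfderiv (𝓡 m) h₂ x v := by
    intro x ξ v
    have d₁ := h₁_smooth.mdifferentiable (by simp) x
    have d₂ := h₂_smooth.mdifferentiable (by simp) x
    have c : ∀ c : ℝ, MDifferentiableAt (𝓡 m) 𝓘(ℝ, ℝ) (fun _ : M => c) x :=
      fun c => mdifferentiableAt_const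
    have e := congrArg (fun L => L v) (mvfderiv_add ((c (ξ 0)).mul d₁) ((c (ξ 1)).mul d₂))
    have e' : ∀ {h : M → ℝ} (k : ℝ), MDifferentiableAt (𝓡 m) 𝓘(ℝ, ℝ) h x →
        mvfderiv (𝓡 m) ((fun _ => k) * h) x v = k * mvfderiv (𝓡 m) h x v := by
      intro h k hh
      rw [mvfderiv_mul (c k) hh, mvfderiv_const]
      simp
    exact e.trans (congrArg₂ (· + ·) (e' _ d₁) (e' _ d₂))
  refine ⟨sumWedge X₁ X₂ Y₁ Y₂ sX₁ sX₂ sY₁ sY₂,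
    fun x => h₁ x • ContinuousLinearMap.proj 0 + h₂ x • ContinuousLinearMap.proj 1, ?_, ?_, ?_⟩
  · intro f g h hf hg hh x
    obtain ⟨Z, hZ⟩ := exists_commutator_vector (sY₁ x) (sY₂ x)
    refine schouten_sumWedge_eq_zero sX₁ sX₂ sY₁ sY₂ (Z := Z) (fun k hk => ?_)
      (fun k hk => hZ k (Filter.Eventually.of_forall hk)) ?_ hf hg hh
    · rw [hX₁, hX₂]
      refine ⟨lieDeriv_generator_comm iY₁ sY₁ _ hk, lieDeriv_generator_comm iY₂ sY₂ _ hk,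
        lieDeriv_generator_comm iY₁ sY₁ _ hk, lieDeriv_generator_comm iY₂ sY₂ _ hk,
        lieDeriv_generator_comm (hX₂ ▸ iX₂) (hX₂ ▸ sX₂) _ hk⟩
    intro α β γ
    -- It remains to see that `Z ∧ X₁ ∧ X₂ = 0` for `Z = [Y₁, Y₂]` at `x`.
    by_cases hli : LinearIndependent ℝ ![X₁ x, X₂ x]
    · have hx₁ : X₁ x ≠ 0 := hli.ne_zero 0
      have near : ∀ᶠ y in 𝓝 x, y ∈ C :=
        (eventually_ne_zero (sX₁ x) hx₁).mono fun y hy => Or.inl (subset_closure hy)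
      have hxV : x ∈ V := V_support near.self_of_nhds
      -- If `Y₁ k` and `Y₂ k` are constant near `x`, then `[Y₁, Y₂] k = 0` at `x`. This is used for
      -- `h₁`, `h₂` and the transverse coordinates of a foliated chart.
      have zero : ∀ k : M → ℝ, (∀ᶠ y in 𝓝 x, ContMDiffAt (𝓡 m) 𝓘(ℝ, ℝ) ∞ k y) →
          ∀ c₁ c₂ : ℝ, (∀ᶠ y in 𝓝 x, lieDeriv Y₁ k y = c₁) →
          (∀ᶠ y in 𝓝 x, lieDeriv Y₂ k y = c₂) → mvfderiv (𝓡 m) k x Z = 0 := by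
        intro k hk c₁ c₂ e₁ e₂
        rw [← hZ k hk, lieDeriv_congr Y₁ e₂, lieDeriv_congr Y₂ e₁, lieDeriv_const,
          lieDeriv_const, sub_zero]
      have Z_level : Z ∈ levelTangent m h₁ h₂ x :=
        ⟨zero h₁ (Filter.Eventually.of_forall h₁_smooth) 1 0 (near.mono fun y hy => (hY₁ y hy).2.1)
          (near.mono fun y hy => (hY₂ y hy).2.1),
        zero h₂ (Filter.Eventually.of_forall h₂_smooth) 0 1 (near.mono fun y hy => (hY₁ y hy).2.2)
          (near.mono fun y hy => (hY₂ y hy).2.2)⟩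
      have Z_tangent : Z ∈ S.tangent x := by
        obtain ⟨φ, hφ, hxφ⟩ := S.cover x hxV
        have nearφ := φ.open_source.eventually_mem hxφ
        rw [S.mem_tangent_iff hφ hxφ]
        intro i hi
        refine zero _ ?_ 0 0 ?_ ?_
        · exact nearφ.mono fun y hy => contMDiffAt_chart_coord (S.charts_subset hφ) hy i
        · filter_upwards [near, nearφ] with y hy hyφ
          exact (S.mem_tangent_iff hφ hyφ _).1 (hY₁ y hy).1 i hi
        · filter_upwards [near, nearφ] with y hy hyφ
          exact (S.mem_tangent_iff hφ hyφ _).1 (hY₂ y hy).1 i hi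
      have Z_orbit : Z ∈ orbitTangent m x := by
        rw [S_compatible.inter_eq x hxV hli]
        exact ⟨Z_tangent, Z_level⟩
      have orbit_le : orbitTangent m x ≤ Submodule.span ℝ {X₁ x, X₂ x} := by
        refine Submodule.span_le.2 ?_
        rintro _ ⟨ξ, rfl⟩
        exact Submodule.mem_span_pair.2 ⟨ξ 0, ξ 1, (gen ξ x).symm⟩
      obtain ⟨a, b, rfl⟩ := Submodule.mem_span_pair.1 (orbit_le Z_orbit)
      simp only [map_add, map_smul, smul_eq_mul]
      ring
    -- Where `X₁, X₂` are dependent, `X₁ ∧ X₂ = 0` and nothing need be known about `Z`.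
    · have minor : ∀ α β : Cotangent m x, α (X₁ x) * β (X₂ x) - α (X₂ x) * β (X₁ x) = 0 := by
        intro α β
        rw [LinearIndependent.pair_iff] at hli
        push Not at hli
        obtain ⟨s, t, hst, hne⟩ := hli
        have e : ∀ δ : Cotangent m x, s * δ (X₁ x) + t * δ (X₂ x) = 0 := fun δ => by
          have := congrArg δ hst
          simpa only [map_add, map_smul, smul_eq_mul, map_zero] using this
        by_cases hs : s = 0
        · refine (mul_eq_zero.1 (?_ : t * _ = 0)).resolve_left (hne hs)
          linear_combination α (X₁ x) * e β - β (X₁ x) * e α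
        · refine (mul_eq_zero.1 (?_ : s * _ = 0)).resolve_left hs
          linear_combination β (X₂ x) * e α - α (X₂ x) * e β
      rw [minor, minor, minor]
      ring
  · intro x ξ
    simp [mul_comm]
  · refine ⟨?_, ?_, ?_, ?_⟩
    · exact (h₁_smooth.smul contMDiff_const).add (h₂_smooth.smul contMDiff_const)
    · intro a f g hf hg x
      simp only [sumWedge_bracket, lieDeriv_comp_smul iX₁ hf, lieDeriv_comp_smul iX₂ hf,
        lieDeriv_comp_smul iY₁ hf, lieDeriv_comp_smul iY₂ hf, lieDeriv_comp_smul iX₁ hg,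
        lieDeriv_comp_smul iX₂ hg, lieDeriv_comp_smul iY₁ hg, lieDeriv_comp_smul iY₂ hg]
    · intro ξ x β
      have eJ : (fun x => (h₁ x • ContinuousLinearMap.proj 0 + h₂ x • ContinuousLinearMap.proj 1 :
          (Fin 2 → ℝ) →L[ℝ] ℝ) ξ) = fun y => ξ 0 * h₁ y + ξ 1 * h₂ y := by
        ext y; simp [mul_comm]
      have z : ∀ η, mvfderiv (𝓡 m) h₁ x (generator m η x) = 0 ∧
          mvfderiv (𝓡 m) h₂ x (generator m η x) = 0 := fun η =>
        ⟨lieDeriv_generator_of_invariant h₁_smooth h₁_invariant η x,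
          lieDeriv_generator_of_invariant h₂_smooth h₂_invariant η x⟩
      have z₁ := z ![1, 0]
      have z₂ := z ![0, 1]
      rw [← hX₁] at z₁
      rw [← hX₂] at z₂
      rw [eJ, sumWedge_apply, gen, map_add, map_smul, map_smul]
      simp only [dJ, z₁.1, z₁.2, z₂.1, z₂.2, smul_eq_mul]
      -- On `C` the pairing `dhᵢ(Yⱼ) = δᵢⱼ` gives the claim; off `C` both generators vanish,
      -- whatever the `Yⱼ` are.
      by_cases hx : x ∈ C
      · simp only [(hY₁ x hx).2.1, (hY₁ x hx).2.2, (hY₂ x hx).2.1, (hY₂ x hx).2.2]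
        ring
      · simp only [(mem_C x hx).1, (mem_C x hx).2, map_zero]
        ring
    · intro a x
      simp only [h₁_invariant, h₂_invariant]
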